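/- Let $L>0$ and let $m_0\in C_c^1(-L,L)$, i.e. $m_0\in C^1(\mathbb R)$ with $\operatorname{supp} m_0\subset(-L,L)$. Put $G(x)=\tfrac12 e^{-|x|}$ and $G'(x)=-\operatorname{sgn}(x)G(x)$. For a space interval $S$ and a time interval $J$, let $C^k_n(S\times J)$ be the functions $f(x,t)$ whose derivatives $\partial_x^\beta f$ ($\beta\le k$) and $\partial_t^\alpha f$ ($\alpha\le n$) exist and are continuous on $S\times J$. A classical solution on $[0,T)$ of the modified Camassa–Holm equation with initial datum $m_0$ is a pair $u\in C^3_1(\mathbb R\times[0,T))$, $m\in C^1_1(\mathbb R\times[0,T))$ with $u,u_x$ bounded on $\mathbb R\times[0,\tau]$ for every $\tau<T$, such that $$m=u-u_{xx}\ \text{ on }\mathbb R\times[0,T),\qquad m_t+[(u^2-u_x^2)m]_x=0\ \text{ on }\mathbb R\times(0,T),\qquad m(\cdot,0)=m_0 .$$ Let $(u,m)$ be a classical solution on $[0,T_{max})$, where $0<T_{max}<\infty$ is the maximal existence time, i.e. there is no classical solution with datum $m_0$ on $[0,T')$ for any $T'>T_{max}$. Let $X\in C^2_1([-L,L]\times[0,T_{max}))$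 satisfy $X(\xi,0)=\xi$ for $\xi\in[-L,L]$ and $$\partial_tX(\xi,t)=U(X(\xi,t),t),\qquad \xi\in[-L,L],\ 0<t<T_{max},$$ $$U(x,t)=\Big(\int_{-L}^{L}G(x-X(\theta,t))m_0(\theta)\,d\theta\Big)^2-\Big(\int_{-L}^{L}G'(x-X(\theta,t))m_0(\theta)\,d\theta\Big)^2,$$ and put $X(\xi,T_{max})=\lim_{t\uparrow T_{max}}X(\xi,t)$. Write $$A^{+}_{T_{max}}=\{X(\xi,T_{max}):\xi\in(-L,L),\ m_0(\xi)>0\},\qquad A^{-}_{T_{max}}=\{X(\xi,T_{max}):\xi\in(-L,L),\ m_0(\xi)<0\}.$$ Then $m(\cdot,t)\in L^1(\mathbb R)$ for $0\le t<T_{max}$, and there is a unique finite signed Radon measure $m(\cdot,T_{max})$ on $\mathbb R$ such that $m(\cdot,t)\,dx\stackrel{*}{\rightharpoonup}m(\cdot,T_{max})$ in $\mathcal M(\mathbb R)=C_0(\mathbb R)^*$ as $t\uparrow T_{max}$. It is the push-forward of $m_0$ under $X(\cdot,T_{max})$, that is, $$m(B,T_{max})=\int_{\{\xi\in[-L,L]\,:\,X(\xi,T_{max})\in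 B\}}m_0(\xi)\,d\xi\quad\text{for every Borel set }B.$$ Moreover: (i) $\operatorname{supp} m(\cdot,T_{max})$ is a compact subset of $(-L,L)$. (ii) $A^\pm_{T_{max}}$ are Borel sets; $m^+_{T_{max}}:=m(\cdot,T_{max})|_{A^+_{T_{max}}}$ is a positive measure, $m^-_{T_{max}}:=m(\cdot,T_{max})|_{A^-_{T_{max}}}$ is a negative measure, and $m(\cdot,T_{max})=m^+_{T_{max}}+m^-_{T_{max}}$. (iii) $\displaystyle\int_{\mathbb R}|m|(dx,T_{max})=\int_{\mathbb R}|m(x,t)|\,dx=\int_{-L}^{L}|m_0(x)|\,dx$ for all $t\in[0,T_{max})$. -/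

import Mathlib

open Set Filter Topology MeasureTheory
open scoped ZeroAtInfty

noncomputable section

/-- The fundamental solution `G(x) = e^{-|x|} / 2` of the Helmholtz operator `1 - ∂ₓₓ`. -/
def helmholtzKernel (x : ℝ) : ℝ := Real.exp (-|x|) / 2

/-- The a.e. derivative `G'(x) = -sgn(x) G(x)` of the Helmholtz kernel (value `0` at the jump). -/
def helmholtzKernel' (x : ℝ) : ℝ := -(Real.sign x) * helmholtzKernel x

/-- The function space `C^k_n(S × J)`, `S` the space domain and `J` the time domain: all space
derivatives up to order `k` and all time derivatives up to order `n` exist (one-sided at boundary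
points belonging to the domain) and are jointly continuous on `S × J`. -/
def MemCkn (k n : ℕ) (S J : Set ℝ) (f : ℝ → ℝ → ℝ) : Prop :=
  (∀ t ∈ J, ContDiffOn ℝ k (fun x => f x t) S) ∧
  (∀ x ∈ S, ContDiffOn ℝ n (fun t => f x t) J) ∧
  (∀ β ≤ k, ContinuousOn
    (fun p : ℝ × ℝ => iteratedDerivWithin β (fun x => f x p.2) S p.1) (S ×ˢ J)) ∧
  (∀ α ≤ n, ContinuousOn
    (fun p : ℝ × ℝ => iteratedDerivWithin α (fun t => f p.1 t) J p.2) (S ×ˢ J))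

/-- `(u, m)` is a classical solution on `ℝ × [0, T)` of the modified Camassa-Holm equation
`m_t + [(u² - u_x²) m]_x = 0`, `m = u - u_xx`, with initial datum `m₀`.
The field `bounded` is the behaviour at infinity: it makes `u` the bounded
solution `G ∗ m` of `u - u_xx = m`, excluding the homogeneous solutions `a eˣ + b e⁻ˣ`. -/
structure IsClassicalSolution (m₀ : ℝ → ℝ) (T : ℝ) (u m : ℝ → ℝ → ℝ) : Prop where
  regular_u : MemCkn 3 1 univ (Ico 0 T) u
  regular_m : MemCkn 1 1 univ (Ico 0 T) m
  bounded : ∀ τ ∈ Ico 0 T, ∃ C : ℝ, ∀ x : ℝ, ∀ t ∈ Icc 0 τ,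
    |u x t| ≤ C ∧ |deriv (fun y => u y t) x| ≤ C
  momentum : ∀ x : ℝ, ∀ t ∈ Ico 0 T, m x t = u x t - iteratedDeriv 2 (fun y => u y t) x
  equation : ∀ x : ℝ, ∀ t ∈ Ioo 0 T,
    deriv (fun s => m x s) t
      + deriv (fun y => ((u y t) ^ 2 - (deriv (fun z => u z t) y) ^ 2) * m y t) x = 0
  initial : ∀ x : ℝ, m x 0 = m₀ x

/-- `(u, m)` is a classical solution with initial datum `m₀` on `ℝ × [0, T)`, and `T < ∞` is the
maximal existence time: no classical solution with this datum exists on a longer interval. -/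
def IsMaximalClassicalSolution (m₀ : ℝ → ℝ) (T : ℝ) (u m : ℝ → ℝ → ℝ) : Prop :=
  IsClassicalSolution m₀ T u m ∧
    ∀ T' > T, ∀ v n : ℝ → ℝ → ℝ, ¬ IsClassicalSolution m₀ T' v n

/-- The Lagrangian velocity
`U(x,t) = (∫ G(x - X(θ,t)) m₀(θ) dθ)² - (∫ G'(x - X(θ,t)) m₀(θ) dθ)²`. -/
def lagrangeVelocity (L : ℝ) (m₀ : ℝ → ℝ) (X : ℝ → ℝ → ℝ) (x t : ℝ) : ℝ :=
  (∫ θ in (-L)..L, helmholtzKernel (x - X θ t) * m₀ θ) ^ 2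
    - (∫ θ in (-L)..L, helmholtzKernel' (x - X θ t) * m₀ θ) ^ 2

/-- `X ∈ C²₁([-L,L] × [0,T))` solves the Lagrange dynamics
`∂ₜ X(ξ,t) = U(X(ξ,t),t)`, `X(ξ,0) = ξ`. -/
structure IsLagrangeFlow (L : ℝ) (m₀ : ℝ → ℝ) (T : ℝ) (X : ℝ → ℝ → ℝ) : Prop where
  regular : MemCkn 2 1 (Icc (-L) L) (Ico 0 T) X
  initial : ∀ ξ ∈ Icc (-L) L, X ξ 0 = ξ
  dynamics : ∀ ξ ∈ Icc (-L) L, ∀ t ∈ Ioo 0 T,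
    HasDerivAt (fun s => X ξ s) (lagrangeVelocity L m₀ X (X ξ t) t) t

/-- As `t → T` from the left, the measures `m(·,t) dx` converge weak-* to the finite signed Borel
measure `μ` in `𝓜(ℝ) = C₀(ℝ)*` (every such measure on `ℝ` is Radon). -/
def WeakStarLimit (m : ℝ → ℝ → ℝ) (T : ℝ) (μ : SignedMeasure ℝ) : Prop :=
  ∀ φ : C₀(ℝ, ℝ), Tendsto (fun t => ∫ x, φ x * m x t) (𝓝[<] T) (𝓝 (∫ᵛ x, φ x ∂•μ))

/-- The image `{X(ξ,T) : ξ ∈ (-L,L), m₀(ξ) > 0}`. -/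
def positiveImage (L : ℝ) (m₀ : ℝ → ℝ) (X : ℝ → ℝ → ℝ) (T : ℝ) : Set ℝ :=
  (fun ξ => X ξ T) '' {ξ ∈ Ioo (-L) L | 0 < m₀ ξ}

/-- The image `{X(ξ,T) : ξ ∈ (-L,L), m₀(ξ) < 0}`. -/
def negativeImage (L : ℝ) (m₀ : ℝ → ℝ) (X : ℝ → ℝ → ℝ) (T : ℝ) : Set ℝ :=
  (fun ξ => X ξ T) '' {ξ ∈ Ioo (-L) L | m₀ ξ < 0}

end

/-!
The hypothesis provides a classical solution `(u, m)` and, separately, a solution `X` of the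
Lagrange dynamics, in which the velocity is computed from `X` itself. The heart of the proof is
that both describe the same motion before the time `T`.

The velocity field `V = u² - u_x²` of the classical solution is bounded on `ℝ × [0, τ]`, `τ < T`,
and `V_x = 2 u_x m` makes it locally Lipschitz in space, so that it has a flow `Y` of
homeomorphisms (`IsRegularField.exists_isFlow`). Along `Y` the momentum `m` solves a linear equation
and keeps its sign (`IsStripSolution.exists_pos_mul_eq`), and the momentum between two
characteristics is conserved (`IsStripSolution.integral_between_eq`). Hence `m(·,t) dx` is the
push-forward of `m₀ dx` under `Y(·,t)`, with the same total variation. In particular `m(·,t)` has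
compact support, the boundedness of `u` and `u_x` forces `u = G ∗ m` and `u_x = G' ∗ m`, and so `Y`
solves the Lagrange dynamics too (`IsTransportedSolution.velocity_eq`). These have a unique
solution, although `G'` jumps, as soon as one of two solutions separates labels
(`IsLagrangeStrip.eq`); therefore `X = Y`.

What happens at `T` is read off from a product formula. For ordered particles `V = P Q`, where
`P = u - u_x` only sees the mass to the left and `Q = u + u_x` only the mass to the right
(`lagrangeVelocity_eq_mul`). So the points `±L` do not move, and the velocities of two labels
differ by at most a multiple of `∫ |m₀|` between them
(`abs_lagrangeVelocity_label_sub_le`). Integrated over `[0, T)`, this shows that `X(·,T)` is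
Lipschitz, is nondecreasing, maps `[-r, r]` into itself if `m₀` vanishes outside it, and never
collapses an interval of labels containing a zero of `m₀`
(`IsLimitFlow.ne_zero_of_eq`). Labels that collide thus carry momentum of one sign, no
cancellation occurs in the push-forward of `m₀` under `X(·,T)`, and the images of `{m₀ > 0}` and
`{m₀ < 0}` form a Hahn decomposition of the limit measure. The weak-* convergence itself is
dominated convergence in `∫ φ(X(θ,t)) m₀(θ) dθ`.
-/

/-! ### Differentiation along a curve -/

/-- Chain rule along a curve for a function of space and time whose two partial derivatives are
jointly continuous on an open time strip. -/
theorem hasDerivAt_along_curve {F Fx Ft : ℝ → ℝ → ℝ} {τ t v : ℝ} {γ : ℝ → ℝ}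
    (hFx : ∀ x, ∀ s ∈ Ioo 0 τ, HasDerivAt (fun y => F y s) (Fx x s) x)
    (hFt : ∀ x, ∀ s ∈ Ioo 0 τ, HasDerivAt (fun r => F x r) (Ft x s) s)
    (cFx : ContinuousOn (fun p : ℝ × ℝ => Fx p.1 p.2) (univ ×ˢ Ioo 0 τ))
    (cFt : ContinuousOn (fun p : ℝ × ℝ => Ft p.1 p.2) (univ ×ˢ Ioo 0 τ))
    (ht : t ∈ Ioo 0 τ) (hγ : HasDerivAt γ v t) :
    HasDerivAt (fun s => F (γ s) s) (Fx (γ t) t * v + Ft (γ t) t) t := by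
  have hopen : IsOpen ((univ : Set ℝ) ×ˢ Ioo 0 τ) := isOpen_univ.prod isOpen_Ioo
  have hmem : (univ : Set ℝ) ×ˢ Ioo 0 τ ∈ 𝓝 (γ t, t) := hopen.mem_nhds ⟨mem_univ _, ht⟩
  have key := hasStrictFDerivAt_uncurry_coprod (𝕜 := ℝ) (u := (γ t, t)) (f := F)
    (f₁ := fun x s => ContinuousLinearMap.toSpanSingleton ℝ (Fx x s))
    (f₂ := fun x s => ContinuousLinearMap.toSpanSingleton ℝ (Ft x s))
    (by
      filter_upwards [hmem] with p hp
      exact (hFx p.1 p.2 hp.2).hasFDerivAt)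
    (by
      filter_upwards [hmem] with p hp
      exact (hFt p.1 p.2 hp.2).hasFDerivAt)
    ((ContinuousLinearMap.toSpanSingletonCLE (𝕜 := ℝ) (E := ℝ)).continuous.continuousAt.comp
      (cFx.continuousAt hmem))
    ((ContinuousLinearMap.toSpanSingletonCLE (𝕜 := ℝ) (E := ℝ)).continuous.continuousAt.comp
      (cFt.continuousAt hmem))
  have h2 : HasDerivAt (fun s => (γ s, s)) (v, (1 : ℝ)) t := hγ.prodMk (hasDerivAt_id t)
  have h3 := HasFDerivAt.comp_hasDerivAt (f := fun s => (γ s, s)) t key.hasFDerivAt h2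
  refine h3.congr_deriv ?_
  simp [Function.HasUncurry.uncurry, mul_comm]

/-! ### The Helmholtz kernel -/

theorem helmholtzKernel_of_nonneg {z : ℝ} (hz : 0 ≤ z) :
    helmholtzKernel z = Real.exp (-z) / 2 := by
  rw [helmholtzKernel, abs_of_nonneg hz]

theorem helmholtzKernel_of_nonpos {z : ℝ} (hz : z ≤ 0) :
    helmholtzKernel z = Real.exp z / 2 := by
  rw [helmholtzKernel, abs_of_nonpos hz, neg_neg]

theorem helmholtzKernel'_of_pos {z : ℝ} (hz : 0 < z) :
    helmholtzKernel' z = -Real.exp (-z) / 2 := by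
  rw [helmholtzKernel', Real.sign_of_pos hz, helmholtzKernel_of_nonneg hz.le]; ring

theorem helmholtzKernel'_of_neg {z : ℝ} (hz : z < 0) :
    helmholtzKernel' z = Real.exp z / 2 := by
  rw [helmholtzKernel', Real.sign_of_neg hz, helmholtzKernel_of_nonpos hz.le]; ring

theorem measurable_helmholtzKernel : Measurable helmholtzKernel := by
  unfold helmholtzKernel; fun_prop

theorem measurable_sign : Measurable Real.sign := by
  unfold Real.sign
  exact Measurable.ite measurableSet_Iio measurable_const
    (Measurable.ite measurableSet_Ioi measurable_const measurable_const)

theorem sign_mul_self_eq_abs (a : ℝ) : Real.sign a * a = |a| := by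
  rcases lt_trichotomy a 0 with h | rfl | h
  · rw [Real.sign_of_neg h, abs_of_neg h]; ring
  · simp
  · rw [Real.sign_of_pos h, abs_of_pos h, one_mul]

theorem sign_pos_mul {E : ℝ} (hE : 0 < E) (a : ℝ) : Real.sign (E * a) = Real.sign a := by
  rcases lt_trichotomy a 0 with h | rfl | h
  · rw [Real.sign_of_neg h, Real.sign_of_neg (mul_neg_of_pos_of_neg hE h)]
  · simp
  · rw [Real.sign_of_pos h, Real.sign_of_pos (mul_pos hE h)]

theorem measurable_helmholtzKernel' : Measurable helmholtzKernel' := by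
  unfold helmholtzKernel'
  exact measurable_sign.neg.mul measurable_helmholtzKernel

theorem abs_helmholtzKernel_le (z : ℝ) : |helmholtzKernel z| ≤ 1 / 2 := by
  have : Real.exp (-|z|) ≤ 1 := Real.exp_le_one_iff.2 (by simp)
  rw [helmholtzKernel, abs_of_pos (by positivity)]; linarith

theorem abs_helmholtzKernel'_le (z : ℝ) : |helmholtzKernel' z| ≤ 1 / 2 := by
  rw [helmholtzKernel', abs_mul, abs_neg]
  have h1 : |Real.sign z| ≤ 1 := by
    rcases Real.sign_apply_eq z with h | h | h <;> rw [h] <;> norm_num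
  nlinarith [abs_helmholtzKernel_le z, abs_nonneg (helmholtzKernel z), abs_nonneg (Real.sign z)]

theorem abs_exp_neg_sub_le {a b : ℝ} (ha : 0 ≤ a) (hb : 0 ≤ b) :
    |Real.exp (-a) - Real.exp (-b)| ≤ |a - b| := by
  wlog h : a ≤ b generalizing a b
  · rw [abs_sub_comm, abs_sub_comm a]; exact this hb ha (not_le.1 h).le
  have h1 : Real.exp (-b) ≤ Real.exp (-a) := Real.exp_le_exp.2 (by linarith)
  have h2 : Real.exp (-a) ≤ 1 := Real.exp_le_one_iff.2 (by linarith)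
  have h3 : 1 - (b - a) ≤ Real.exp (-(b - a)) := by linarith [Real.add_one_le_exp (-(b - a))]
  have h4 : Real.exp (-b) = Real.exp (-a) * Real.exp (-(b - a)) := by
    rw [← Real.exp_add]; ring_nf
  rw [abs_of_nonneg (by linarith), abs_of_nonpos (by linarith), h4]
  nlinarith [Real.exp_pos (-a)]

theorem abs_helmholtzKernel_sub_le (a b : ℝ) :
    |helmholtzKernel a - helmholtzKernel b| ≤ |a - b| := by
  have h1 := abs_exp_neg_sub_le (abs_nonneg a) (abs_nonneg b)
  have h2 := abs_abs_sub_abs_le_abs_sub a b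
  rw [helmholtzKernel, helmholtzKernel, ← sub_div, abs_div, abs_two]
  linarith [abs_nonneg (Real.exp (-|a|) - Real.exp (-|b|))]

/-- `G'` is Lipschitz away from its jump: if the second argument is farther from the jump than
the two arguments are from each other, both lie on the same side of it. -/
theorem abs_helmholtzKernel'_sub_le {a b : ℝ} (hab : |a - b| < |b|) :
    |helmholtzKernel' a - helmholtzKernel' b| ≤ |a - b| := by
  have h0 := abs_helmholtzKernel_sub_le a b
  rcases lt_trichotomy b 0 with hb | hb | hb
  · have ha : a < 0 := by
      rw [abs_of_neg hb] at hab; linarith [le_abs_self (a - b)]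
    rw [helmholtzKernel', helmholtzKernel', Real.sign_of_neg ha, Real.sign_of_neg hb]
    simpa using h0
  · subst hb; simp at hab; linarith [abs_nonneg a]
  · have ha : 0 < a := by
      rw [abs_of_pos hb] at hab; linarith [neg_abs_le (a - b)]
    rw [helmholtzKernel', helmholtzKernel', Real.sign_of_pos ha, Real.sign_of_pos hb]
    rw [abs_sub_comm] at h0
    convert h0 using 2; ring

/-- A bounded function with bounded derivative solving `u - u'' = m`, where `m` is continuous with
bounded support, is the convolution `G ∗ m`, and its derivative is `G' ∗ m`. -/
theorem eq_integral_helmholtzKernel {u u' u'' m : ℝ → ℝ} {C R : ℝ}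
    (hu : ∀ x, HasDerivAt u (u' x) x) (hu' : ∀ x, HasDerivAt u' (u'' x) x)
    (hm : ∀ x, m x = u x - u'' x) (cm : Continuous m) (hR : ∀ x, R < |x| → m x = 0)
    (bu : ∀ x, |u x| ≤ C) (bu' : ∀ x, |u' x| ≤ C) (x : ℝ) :
    u x = ∫ y, helmholtzKernel (x - y) * m y ∧ u' x = ∫ y, helmholtzKernel' (x - y) * m y := by
  have hcs : HasCompactSupport m := HasCompactSupport.intro (isCompact_Icc (a := -R) (b := R))
    (fun y hy => hR y (by
      by_contra h
      exact hy (abs_le.1 (not_lt.1 h))))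
  have i1 : Integrable (fun y => Real.exp y * m y) :=
    (Real.continuous_exp.mul cm).integrable_of_hasCompactSupport hcs.mul_left
  have i2 : Integrable (fun y => Real.exp (-y) * m y) :=
    ((Real.continuous_exp.comp continuous_neg).mul cm).integrable_of_hasCompactSupport hcs.mul_left
  -- `(eʸ (u - u'))' = eʸ m` and `(e⁻ʸ (u + u'))' = -e⁻ʸ m`; boundedness kills the terms at `∓∞`
  have L1 : ∫ y in Iic x, Real.exp y * m y = Real.exp x * (u x - u' x) := by
    have := integral_Iic_of_hasDerivAt_of_tendsto' (a := x) (m := (0 : ℝ))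
      (f := fun y => Real.exp y * (u y - u' y)) (f' := fun y => Real.exp y * m y)
      (fun y _ => by
        refine ((Real.hasDerivAt_exp y).mul ((hu y).sub (hu' y))).congr_deriv ?_
        simp only [hm, Pi.sub_apply]; ring)
      i1.integrableOn
      (by
        refine Real.tendsto_exp_atBot.zero_mul_isBoundedUnder_le ?_
        refine isBoundedUnder_of ⟨2 * C, fun y => ?_⟩
        have := abs_sub (u y) (u' y)
        simp only [Function.comp, Real.norm_eq_abs]
        linarith [bu y, bu' y])
    simpa using this
  have L2 : ∫ y in Ioi x, Real.exp (-y) * m y = Real.exp (-x) * (u x + u' x) := by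
    have := integral_Ioi_of_hasDerivAt_of_tendsto' (a := x) (m := (0 : ℝ))
      (f := fun y => -(Real.exp (-y) * (u y + u' y))) (f' := fun y => Real.exp (-y) * m y)
      (fun y _ => by
        have e : HasDerivAt (fun y : ℝ => Real.exp (-y)) (Real.exp (-y) * (-1)) y :=
          (Real.hasDerivAt_exp (-y)).comp y (hasDerivAt_neg y)
        refine (e.mul ((hu y).add (hu' y))).neg.congr_deriv ?_
        simp only [hm, Pi.add_apply]; ring)
      i2.integrableOn
      (by
        rw [← neg_zero]
        refine Tendsto.neg ?_
        refine (Real.tendsto_exp_atBot.comp tendsto_neg_atTop_atBot).zero_mul_isBoundedUnder_le ?_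
        refine isBoundedUnder_of ⟨2 * C, fun y => ?_⟩
        have := abs_add_le (u y) (u' y)
        simp only [Function.comp, Real.norm_eq_abs]
        linarith [bu y, bu' y])
    simpa using this
  have hE : Real.exp (-x) * Real.exp x = 1 := by rw [← Real.exp_add]; simp
  have split : ∀ k : ℝ → ℝ, Integrable (fun y => k y * m y) → ∀ c d : ℝ,
      (∀ y < x, k y = c * Real.exp y) → (∀ y > x, k y = d * Real.exp (-y)) →
      ∫ y, k y * m y = c * (Real.exp x * (u x - u' x)) + d * (Real.exp (-x) * (u x + u' x)) := by
    intro k ik c d hc hd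
    rw [← integral_add_compl measurableSet_Iic ik, compl_Iic, ← L1, ← L2, ← integral_const_mul,
      ← integral_const_mul]
    congr 1
    · rw [integral_Iic_eq_integral_Iio, integral_Iic_eq_integral_Iio]
      refine setIntegral_congr_fun measurableSet_Iio fun y hy => ?_
      simp only [hc y hy]; ring
    · refine setIntegral_congr_fun measurableSet_Ioi fun y hy => ?_
      simp only [hd y hy]; ring
  have im : Integrable m := cm.integrable_of_hasCompactSupport hcs
  have hk : ∀ k : ℝ → ℝ, Measurable k → (∀ z, |k z| ≤ 1 / 2) →
      Integrable (fun y => k (x - y) * m y) := fun k mk bk =>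
    im.bdd_mul (mk.comp (measurable_const.sub measurable_id)).aestronglyMeasurable
      (Eventually.of_forall fun y => by simpa using bk (x - y))
  constructor
  · rw [split _ (hk _ measurable_helmholtzKernel abs_helmholtzKernel_le)
      (Real.exp (-x) / 2) (Real.exp x / 2)]
    · linear_combination (-u x) * hE
    · intro y hy
      rw [helmholtzKernel_of_nonneg (by linarith), neg_sub, sub_eq_add_neg, Real.exp_add]; ring
    · intro y hy
      rw [helmholtzKernel_of_nonpos (by linarith [hy.lt]), sub_eq_add_neg, Real.exp_add]; ring
  · rw [split _ (hk _ measurable_helmholtzKernel' abs_helmholtzKernel'_le)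
      (-Real.exp (-x) / 2) (Real.exp x / 2)]
    · linear_combination (-u' x) * hE
    · intro y hy
      rw [helmholtzKernel'_of_pos (by linarith), neg_sub, sub_eq_add_neg, Real.exp_add]; ring
    · intro y hy
      rw [helmholtzKernel'_of_neg (by linarith [hy.lt]), sub_eq_add_neg, Real.exp_add]; ring

/-! ### Push-forward of signed densities -/

/-- The positive part `m⁺ dμ` of the measure with real density `m`. -/
noncomputable def posPartMeasure (μ : Measure ℝ) (m : ℝ → ℝ) : Measure ℝ :=
  μ.withDensity fun x => ENNReal.ofReal (m x)

theorem isFiniteMeasure_posPartMeasure {μ : Measure ℝ} {m : ℝ → ℝ} (im : Integrable m μ) :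
    IsFiniteMeasure (posPartMeasure μ m) :=
  isFiniteMeasure_withDensity_ofReal im.2

theorem integral_posPartMeasure_sub {μ : Measure ℝ} {m φ : ℝ → ℝ} (im : Integrable m μ)
    (mm : Measurable m) (mφ : Measurable φ) {C : ℝ} (bφ : ∀ x, |φ x| ≤ C) :
    ∫ x, φ x ∂(posPartMeasure μ m) - ∫ x, φ x ∂(posPartMeasure μ fun x => -m x)
      = ∫ x, φ x * m x ∂μ := by
  have h1 : ∀ k : ℝ → ℝ, Measurable k →
      ∫ x, φ x ∂(posPartMeasure μ k) = ∫ x, φ x * max (k x) 0 ∂μ := by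
    intro k mk
    rw [posPartMeasure, integral_withDensity_eq_integral_toReal_smul mk.ennreal_ofReal
      (Eventually.of_forall fun x => ENNReal.ofReal_lt_top)]
    refine integral_congr_ae (Eventually.of_forall fun x => ?_)
    simp [ENNReal.toReal_ofReal', mul_comm]
  have hi : ∀ k : ℝ → ℝ, Integrable k μ → Integrable (fun x => φ x * max (k x) 0) μ :=
    fun k ik => ik.pos_part.bdd_mul mφ.aestronglyMeasurable
      (Eventually.of_forall fun x => by simpa using bφ x)
  rw [h1 _ mm, h1 (fun x => -m x) mm.neg, ← integral_sub (hi _ im) (hi (fun x => -m x) im.neg)]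
  refine integral_congr_ae (Eventually.of_forall fun x => ?_)
  simp only [← mul_sub]
  congr 1
  rcases le_total 0 (m x) with h | h
  · rw [max_eq_left h, max_eq_right (by simpa using h), sub_zero]
  · rw [max_eq_right h, max_eq_left (by simpa using h)]; ring

theorem posPartMeasure_real_sub {μ : Measure ℝ} {m : ℝ → ℝ} (im : Integrable m μ)
    {B : Set ℝ} (hB : MeasurableSet B) :
    (posPartMeasure μ m).real B - (posPartMeasure μ fun x => -m x).real B
      = ∫ x in B, m x ∂μ := by
  rw [integral_eq_lintegral_pos_part_sub_lintegral_neg_part im.integrableOn, measureReal_def,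
    measureReal_def, posPartMeasure, posPartMeasure, withDensity_apply _ hB, withDensity_apply _ hB]

/-- Two integrable densities whose distribution functions correspond under an increasing
homeomorphism `Y` are push-forwards of each other under `Y`. -/
theorem integral_mul_eq_of_cdf_eq {Y m m₀ : ℝ → ℝ} (hY : StrictMono Y) (cY : Continuous Y)
    (sY : Function.Surjective Y) (im : Integrable m) (im₀ : Integrable m₀)
    (mm : Measurable m) (mm₀ : Measurable m₀)
    (h : ∀ ξ, ∫ x in Iic (Y ξ), m x = ∫ θ in Iic ξ, m₀ θ) {φ : ℝ → ℝ} (mφ : Measurable φ)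
    {C : ℝ} (bφ : ∀ x, |φ x| ≤ C) : ∫ x, φ x * m x = ∫ θ, φ (Y θ) * m₀ θ := by
  have mY : Measurable Y := cY.measurable
  have f1 := isFiniteMeasure_posPartMeasure im
  have f2 : IsFiniteMeasure (posPartMeasure volume fun x => -m x) :=
    isFiniteMeasure_posPartMeasure im.neg
  have f3 := isFiniteMeasure_posPartMeasure im₀
  have f4 : IsFiniteMeasure (posPartMeasure volume fun x => -m₀ x) :=
    isFiniteMeasure_posPartMeasure im₀.neg
  -- negative parts are moved to the other side, so that only positive measures are compared
  have heq : posPartMeasure volume m + (posPartMeasure volume fun x => -m₀ x).map Y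
      = posPartMeasure volume (fun x => -m x) + (posPartMeasure volume m₀).map Y := by
    refine Measure.ext_of_Iic _ _ fun a => ?_
    obtain ⟨ξ, rfl⟩ := sY a
    have hpre : Y ⁻¹' Iic (Y ξ) = Iic ξ := by ext θ; simp [hY.le_iff_le]
    have e1 := posPartMeasure_real_sub im (measurableSet_Iic (a := Y ξ))
    have e2 := posPartMeasure_real_sub im₀ (measurableSet_Iic (a := ξ))
    rw [h ξ] at e1
    rw [← measureReal_eq_measureReal_iff, measureReal_add_apply, measureReal_add_apply,
      map_measureReal_apply mY measurableSet_Iic, map_measureReal_apply mY measurableSet_Iic, hpre]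
    linarith
  have hint : ∀ ν : Measure ℝ, IsFiniteMeasure ν → Integrable φ ν := fun ν _ =>
    Integrable.of_bound mφ.aestronglyMeasurable C
      (Eventually.of_forall fun x => by simpa using bφ x)
  have : ∫ x, φ x ∂_ = ∫ x, φ x ∂_ := congrArg (fun ν : Measure ℝ => ∫ x, φ x ∂ν) heq
  rw [integral_add_measure (hint _ f1) (hint _ inferInstance),
    integral_add_measure (hint _ f2) (hint _ inferInstance),
    integral_map mY.aemeasurable mφ.aestronglyMeasurable,
    integral_map mY.aemeasurable mφ.aestronglyMeasurable] at this
  have e₀ := integral_posPartMeasure_sub im₀ mm₀ (mφ.comp mY) (fun x => bφ (Y x))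
  simp only [Function.comp] at e₀
  rw [← integral_posPartMeasure_sub im mm mφ bφ, ← e₀]
  linarith

/-! ### Characteristics and flows of a velocity field -/

/-- `γ` is a characteristic on `[0, τ]` of the time-dependent velocity field `V(x,t)`. -/
def IsCharacteristic (V : ℝ → ℝ → ℝ) (τ : ℝ) (γ : ℝ → ℝ) : Prop :=
  ∀ t ∈ Icc 0 τ, HasDerivWithinAt γ (V (γ t) t) (Icc 0 τ) t

/-- A velocity field on `ℝ × [0, τ]` bounded by `K`, continuous in time, and Lipschitz in space on
bounded sets, uniformly in time. -/
structure IsRegularField (V : ℝ → ℝ → ℝ) (τ K : ℝ) : Prop where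
  bound : ∀ x, ∀ t ∈ Icc 0 τ, |V x t| ≤ K
  cont : ∀ x, ContinuousOn (fun t => V x t) (Icc 0 τ)
  lip : ∀ R : ℝ, ∃ κ : NNReal, ∀ t ∈ Icc 0 τ, LipschitzOnWith κ (fun x => V x t) (Icc (-R) R)

namespace IsCharacteristic

variable {V : ℝ → ℝ → ℝ} {τ K : ℝ} {γ γ₁ γ₂ : ℝ → ℝ}

theorem continuousOn (h : IsCharacteristic V τ γ) : ContinuousOn γ (Icc 0 τ) :=
  fun t ht => (h t ht).continuousWithinAt

theorem hasDerivAt (h : IsCharacteristic V τ γ) {t : ℝ} (ht : t ∈ Ioo 0 τ) :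
    HasDerivAt γ (V (γ t) t) t :=
  (h t (Ioo_subset_Icc_self ht)).hasDerivAt (Icc_mem_nhds ht.1 ht.2)

theorem abs_sub_le (h : IsCharacteristic V τ γ) (hV : IsRegularField V τ K) {t s : ℝ}
    (ht : t ∈ Icc 0 τ) (hs : s ∈ Icc 0 τ) : |γ t - γ s| ≤ K * |t - s| := by
  have := (convex_Icc 0 τ).norm_image_sub_le_of_norm_hasDerivWithin_le
    (f := γ) (C := K) (fun x hx => h x hx) (fun x hx => hV.bound _ _ hx) hs ht
  simpa using this

end IsCharacteristic

theorem IsRegularField.exists_isCharacteristic {V : ℝ → ℝ → ℝ} {τ K : ℝ}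
    (hV : IsRegularField V τ K) (x₀ : ℝ) {t₀ : ℝ} (ht₀ : t₀ ∈ Icc 0 τ) :
    ∃ γ : ℝ → ℝ, γ t₀ = x₀ ∧ IsCharacteristic V τ γ := by
  have hτ : 0 ≤ τ := ht₀.1.trans ht₀.2
  have hK : 0 ≤ K := (abs_nonneg _).trans (hV.bound 0 t₀ ht₀)
  -- a solution moves by at most `K τ`, so one ball of this radius serves the whole time interval
  obtain ⟨κ, hκ⟩ := hV.lip (|x₀| + K * τ)
  have hball : Metric.closedBall x₀ (K * τ) ⊆ Icc (-(|x₀| + K * τ)) (|x₀| + K * τ) := by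
    intro y hy
    rw [Real.closedBall_eq_Icc] at hy
    constructor
    · linarith [hy.1, neg_abs_le x₀]
    · linarith [hy.2, le_abs_self x₀]
  have hPL : IsPicardLindelof (fun t x => V x t) (⟨t₀, ht₀⟩ : Icc 0 τ) x₀
      ⟨K * τ, by positivity⟩ 0 ⟨K, hK⟩ κ :=
    { lipschitzOnWith := fun t ht => (hκ t ht).mono hball
      continuousOn := fun x _ => hV.cont x
      norm_le := fun t ht x _ => hV.bound x t ht
      mul_max_le := by
        have : max (τ - t₀) (t₀ - 0) ≤ τ := max_le (by linarith [ht₀.1]) (by linarith [ht₀.2])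
        change K * max (τ - t₀) (t₀ - 0) ≤ K * τ - 0
        rw [sub_zero (K * τ)]
        exact mul_le_mul_of_nonneg_left this hK }
  obtain ⟨γ, h1, h2⟩ := hPL.exists_eq_forall_mem_Icc_hasDerivWithinAt₀
  exact ⟨γ, h1, h2⟩

namespace IsRegularField

variable {V : ℝ → ℝ → ℝ} {τ K : ℝ}

/-- Characteristics issued from a bounded set depend on each other in a bi-Lipschitz way, forwards
and backwards in time: `w² e^{-2κt}` decreases and `w² e^{2κt}` increases, where `w` is the
difference of two characteristics. -/
theorem exists_abs_sub_le (hV : IsRegularField V τ K) (R : ℝ) :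
    ∃ C > 0, ∀ γ₁ γ₂, IsCharacteristic V τ γ₁ → IsCharacteristic V τ γ₂ → |γ₁ 0| ≤ R →
      |γ₂ 0| ≤ R → ∀ s ∈ Icc 0 τ, ∀ t ∈ Icc 0 τ, |γ₁ t - γ₂ t| ≤ C * |γ₁ s - γ₂ s| := by
  obtain ⟨κ, hκ⟩ := hV.lip (R + K * τ)
  refine ⟨Real.exp (κ * τ), Real.exp_pos _, fun γ₁ γ₂ h₁ h₂ b₁ b₂ s hs t ht => ?_⟩
  have hτ : 0 ≤ τ := hs.1.trans hs.2
  have hK : 0 ≤ K := (abs_nonneg _).trans (hV.bound 0 s hs)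
  have hbox : ∀ γ, IsCharacteristic V τ γ → |γ 0| ≤ R → ∀ r ∈ Icc 0 τ,
      γ r ∈ Icc (-(R + K * τ)) (R + K * τ) := by
    intro γ h b r hr
    have h1 := h.abs_sub_le hV hr (left_mem_Icc.2 hτ)
    rw [sub_zero, abs_of_nonneg hr.1] at h1
    have h2 : K * r ≤ K * τ := mul_le_mul_of_nonneg_left hr.2 hK
    rw [abs_le] at h1 b
    constructor <;> linarith [h1.1, h1.2, b.1, b.2]
  have hlip : ∀ r ∈ Icc 0 τ, |V (γ₁ r) r - V (γ₂ r) r| ≤ κ * |γ₁ r - γ₂ r| := fun r hr => by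
    simpa [Real.dist_eq] using
      (hκ r hr).dist_le_mul _ (hbox γ₁ h₁ b₁ r hr) _ (hbox γ₂ h₂ b₂ r hr)
  have hd : ∀ c : ℝ, ∀ r ∈ Ioo 0 τ, HasDerivAt
      (fun r => (γ₁ r - γ₂ r) ^ 2 * Real.exp (c * r))
      ((2 * (γ₁ r - γ₂ r) * (V (γ₁ r) r - V (γ₂ r) r) + c * (γ₁ r - γ₂ r) ^ 2)
        * Real.exp (c * r)) r := by
    intro c r hr
    have e : HasDerivAt (fun r : ℝ => Real.exp (c * r)) (Real.exp (c * r) * c) r := by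
      simpa using (((hasDerivAt_id r).const_mul c).exp)
    refine ((((h₁.hasDerivAt hr).sub (h₂.hasDerivAt hr)).pow 2).mul e).congr_deriv ?_
    simp only [Pi.sub_apply, Pi.pow_apply]
    push_cast
    ring
  have hc : ∀ c : ℝ, ContinuousOn (fun r => (γ₁ r - γ₂ r) ^ 2 * Real.exp (c * r)) (Icc 0 τ) :=
    fun c => ((h₁.continuousOn.sub h₂.continuousOn).pow 2).mul (by fun_prop)
  have hprod : ∀ r ∈ Icc 0 τ,
      |(γ₁ r - γ₂ r) * (V (γ₁ r) r - V (γ₂ r) r)| ≤ κ * (γ₁ r - γ₂ r) ^ 2 := by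
    intro r hr
    rw [abs_mul, ← sq_abs (γ₁ r - γ₂ r)]
    nlinarith [hlip r hr, abs_nonneg (γ₁ r - γ₂ r)]
  have hanti : AntitoneOn (fun r => (γ₁ r - γ₂ r) ^ 2 * Real.exp (-2 * κ * r)) (Icc 0 τ) := by
    refine antitoneOn_of_deriv_nonpos (convex_Icc 0 τ) (hc _) ?_ ?_ <;> rw [interior_Icc]
    · exact fun r hr => (hd _ r hr).differentiableAt.differentiableWithinAt
    · intro r hr
      rw [(hd _ r hr).deriv]
      refine mul_nonpos_of_nonpos_of_nonneg ?_ (Real.exp_pos _).le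
      linarith [(abs_le.1 (hprod r (Ioo_subset_Icc_self hr))).2]
  have hmono : MonotoneOn (fun r => (γ₁ r - γ₂ r) ^ 2 * Real.exp (2 * κ * r)) (Icc 0 τ) := by
    refine monotoneOn_of_deriv_nonneg (convex_Icc 0 τ) (hc _) ?_ ?_ <;> rw [interior_Icc]
    · exact fun r hr => (hd _ r hr).differentiableAt.differentiableWithinAt
    · intro r hr
      rw [(hd _ r hr).deriv]
      refine mul_nonneg ?_ (Real.exp_pos _).le
      linarith [(abs_le.1 (hprod r (Ioo_subset_Icc_self hr))).1]
  have hfin : ∀ a : ℝ, a ≤ 2 * (κ * τ) →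
      (γ₁ t - γ₂ t) ^ 2 ≤ (γ₁ s - γ₂ s) ^ 2 * Real.exp a →
      |γ₁ t - γ₂ t| ≤ Real.exp (κ * τ) * |γ₁ s - γ₂ s| := by
    intro a ha h
    refine abs_le_of_sq_le_sq' ?_ (by positivity) |> abs_le.2
    rw [mul_pow, sq_abs, ← Real.exp_nat_mul, mul_comm]
    refine h.trans (mul_le_mul_of_nonneg_left (Real.exp_le_exp.2 ?_) (sq_nonneg _))
    push_cast; exact ha
  have hκ0 : (0 : ℝ) ≤ κ := κ.2
  have hexp : ∀ a b : ℝ, (γ₁ t - γ₂ t) ^ 2 * Real.exp a ≤ (γ₁ s - γ₂ s) ^ 2 * Real.exp b →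
      (γ₁ t - γ₂ t) ^ 2 ≤ (γ₁ s - γ₂ s) ^ 2 * Real.exp (b - a) := by
    intro a b h
    rw [Real.exp_sub, ← mul_div_assoc, le_div_iff₀ (Real.exp_pos _)]
    exact h
  rcases le_total s t with hst | hst
  · refine hfin _ ?_ (hexp _ _ (hanti hs ht hst))
    nlinarith [mul_le_mul_of_nonneg_left (show t - s ≤ τ by linarith [hs.1, ht.2]) hκ0]
  · refine hfin _ ?_ (hexp _ _ (hmono ht hs hst))
    nlinarith [mul_le_mul_of_nonneg_left (show s - t ≤ τ by linarith [ht.1, hs.2]) hκ0]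

/-- Distinct characteristics never meet, so they keep their order. -/
theorem lt_of_lt (hV : IsRegularField V τ K) {γ₁ γ₂ : ℝ → ℝ} (h₁ : IsCharacteristic V τ γ₁)
    (h₂ : IsCharacteristic V τ γ₂) (h0 : γ₁ 0 < γ₂ 0) {t : ℝ} (ht : t ∈ Icc 0 τ) :
    γ₁ t < γ₂ t := by
  by_contra! hle
  have h0m : (0 : ℝ) ∈ Icc 0 τ := left_mem_Icc.2 (ht.1.trans ht.2)
  obtain ⟨C, -, hC⟩ := hV.exists_abs_sub_le (max |γ₁ 0| |γ₂ 0|)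
  have hsub : Icc 0 t ⊆ Icc 0 τ := Icc_subset_Icc_right ht.2
  have hivt := intermediate_value_Icc ht.1
    ((h₁.continuousOn.sub h₂.continuousOn).mono hsub)
  obtain ⟨s, hs, hs0⟩ := hivt (show (0 : ℝ) ∈ Icc _ _ from
    ⟨by simp only [Pi.sub_apply]; linarith, by simp only [Pi.sub_apply]; linarith⟩)
  have := hC γ₁ γ₂ h₁ h₂ (le_max_left _ _) (le_max_right _ _) s (hsub hs) 0 h0m
  simp only [Pi.sub_apply] at hs0
  rw [hs0, abs_zero, mul_zero] at this
  have := abs_nonpos_iff.1 this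
  linarith

end IsRegularField

/-- `Y(ξ, ·)` is the characteristic of `V` starting at `ξ`. -/
structure IsFlow (V : ℝ → ℝ → ℝ) (τ : ℝ) (Y : ℝ → ℝ → ℝ) : Prop where
  initial : ∀ ξ, Y ξ 0 = ξ
  char : ∀ ξ, IsCharacteristic V τ (Y ξ)

theorem IsRegularField.exists_isFlow {V : ℝ → ℝ → ℝ} {τ K : ℝ}
    (hV : IsRegularField V τ K) (hτ : 0 ≤ τ) : ∃ Y, IsFlow V τ Y := by
  choose Y h1 h2 using fun ξ => hV.exists_isCharacteristic ξ (left_mem_Icc.2 hτ)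
  exact ⟨Y, h1, h2⟩

namespace IsFlow

variable {V Y : ℝ → ℝ → ℝ} {τ K t : ℝ}

theorem strictMono (hY : IsFlow V τ Y) (hV : IsRegularField V τ K) (ht : t ∈ Icc 0 τ) :
    StrictMono fun ξ => Y ξ t := fun ξ η h =>
  hV.lt_of_lt (hY.char ξ) (hY.char η) (by rwa [hY.initial, hY.initial]) ht

theorem exists_abs_sub_le (hY : IsFlow V τ Y) (hV : IsRegularField V τ K) (hτ : 0 ≤ τ) (R : ℝ) :
    ∃ C > 0, ∀ ξ η, |ξ| ≤ R → |η| ≤ R → ∀ t ∈ Icc 0 τ,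
      |Y ξ t - Y η t| ≤ C * |ξ - η| ∧ |ξ - η| ≤ C * |Y ξ t - Y η t| := by
  obtain ⟨C, hC, h⟩ := hV.exists_abs_sub_le R
  refine ⟨C, hC, fun ξ η hξ hη t ht => ?_⟩
  have h0 : (0 : ℝ) ∈ Icc 0 τ := left_mem_Icc.2 hτ
  have e := h (Y ξ) (Y η) (hY.char ξ) (hY.char η) (by rwa [hY.initial]) (by rwa [hY.initial])
  have e1 := e 0 h0 t ht
  have e2 := e t ht 0 h0
  rw [hY.initial, hY.initial] at e1 e2
  exact ⟨e1, e2⟩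

theorem eq_of_isCharacteristic (hY : IsFlow V τ Y) (hV : IsRegularField V τ K) {γ : ℝ → ℝ}
    (hγ : IsCharacteristic V τ γ) (ht : t ∈ Icc 0 τ) : Y (γ 0) t = γ t := by
  obtain ⟨C, -, h⟩ := hV.exists_abs_sub_le |γ 0|
  have := h (Y (γ 0)) γ (hY.char _) hγ (by rw [hY.initial]) le_rfl 0
    (left_mem_Icc.2 (ht.1.trans ht.2)) t ht
  rw [hY.initial, sub_self, abs_zero, mul_zero] at this
  exact sub_eq_zero.1 (abs_nonpos_iff.1 this)

theorem surjective (hY : IsFlow V τ Y) (hV : IsRegularField V τ K) (ht : t ∈ Icc 0 τ) :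
    Function.Surjective fun ξ => Y ξ t := by
  intro x
  obtain ⟨γ, h1, h2⟩ := hV.exists_isCharacteristic x ht
  exact ⟨γ 0, by simpa only [h1] using hY.eq_of_isCharacteristic hV h2 ht⟩

theorem continuous (hY : IsFlow V τ Y) (hV : IsRegularField V τ K) (ht : t ∈ Icc 0 τ) :
    Continuous fun ξ => Y ξ t :=
  ((hY.strictMono hV ht).orderIsoOfSurjective _ (hY.surjective hV ht)).continuous

theorem continuousOn_uncurry (hY : IsFlow V τ Y) (hV : IsRegularField V τ K) (hτ : 0 ≤ τ) (R : ℝ) :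
    ContinuousOn (fun p : ℝ × ℝ => Y p.1 p.2) (Icc (-R) R ×ˢ Icc 0 τ) := by
  obtain ⟨C, hC, h⟩ := hY.exists_abs_sub_le hV hτ R
  refine continuousOn_prod_of_continuousOn_lipschitzOnWith _ C.toNNReal
    (fun ξ hξ => (hY.char ξ).continuousOn) (fun t ht => ?_)
  refine LipschitzOnWith.of_dist_le_mul fun ξ hξ η hη => ?_
  rw [Real.coe_toNNReal _ hC.le]
  exact (h ξ η (abs_le.2 hξ) (abs_le.2 hη) t ht).1

end IsFlow

/-! ### Classical solutions along characteristics -/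

/-- What the argument uses of a classical solution on a closed strip `ℝ × [0, τ]`: `ux` and `mx`
are the space derivatives of `u` and `m`, the relation `m = u - u_xx` reads `∂ₓ ux = u - m`, and
the product rule together with `∂ₓ(u² - ux²) = 2 ux m` turns the conservation law into
`m_t = -(2 ux m² + (u² - ux²) m_x)`. -/
structure IsStripSolution (u ux m mx : ℝ → ℝ → ℝ) (τ C : ℝ) : Prop where
  hasDerivAt_u : ∀ x, ∀ t ∈ Icc 0 τ, HasDerivAt (fun y => u y t) (ux x t) x
  hasDerivAt_ux : ∀ x, ∀ t ∈ Icc 0 τ, HasDerivAt (fun y => ux y t) (u x t - m x t) x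
  hasDerivAt_m : ∀ x, ∀ t ∈ Icc 0 τ, HasDerivAt (fun y => m y t) (mx x t) x
  hasDerivAt_time : ∀ x, ∀ t ∈ Ioo 0 τ, HasDerivAt (fun s => m x s)
    (-(2 * ux x t * m x t * m x t + (u x t ^ 2 - ux x t ^ 2) * mx x t)) t
  cont_u : ContinuousOn (fun p : ℝ × ℝ => u p.1 p.2) (univ ×ˢ Icc 0 τ)
  cont_ux : ContinuousOn (fun p : ℝ × ℝ => ux p.1 p.2) (univ ×ˢ Icc 0 τ)
  cont_m : ContinuousOn (fun p : ℝ × ℝ => m p.1 p.2) (univ ×ˢ Icc 0 τ)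
  cont_mx : ContinuousOn (fun p : ℝ × ℝ => mx p.1 p.2) (univ ×ˢ Icc 0 τ)
  bound_u : ∀ x, ∀ t ∈ Icc 0 τ, |u x t| ≤ C
  bound_ux : ∀ x, ∀ t ∈ Icc 0 τ, |ux x t| ≤ C

theorem hasDerivAt_sq_sub_sq {u ux m : ℝ → ℝ} {x : ℝ} (hu : HasDerivAt u (ux x) x)
    (hux : HasDerivAt ux (u x - m x) x) :
    HasDerivAt (fun y => u y ^ 2 - ux y ^ 2) (2 * ux x * m x) x := by
  refine ((hu.pow 2).sub (hux.pow 2)).congr_deriv ?_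
  push_cast; ring

theorem IsClassicalSolution.exists_isStripSolution {m₀ : ℝ → ℝ} {T τ : ℝ} {u m : ℝ → ℝ → ℝ}
    (h : IsClassicalSolution m₀ T u m) (hτ : τ ∈ Ico 0 T) :
    ∃ C, IsStripSolution u (fun x t => deriv (fun y => u y t) x) m
      (fun x t => deriv (fun y => m y t) x) τ C := by
  obtain ⟨C, hC⟩ := h.bounded τ hτ
  have hsub : Icc 0 τ ⊆ Ico 0 T := fun t ht => ⟨ht.1, ht.2.trans_lt hτ.2⟩
  have hu3 : ∀ t ∈ Icc 0 τ, ContDiff ℝ 3 (fun y => u y t) := fun t ht =>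
    contDiffOn_univ.1 (h.regular_u.1 t (hsub ht))
  have hm1 : ∀ t ∈ Icc 0 τ, ContDiff ℝ 1 (fun y => m y t) := fun t ht =>
    contDiffOn_univ.1 (h.regular_m.1 t (hsub ht))
  have hu : ∀ x, ∀ t ∈ Icc 0 τ, HasDerivAt (fun y => u y t) (deriv (fun y => u y t) x) x :=
    fun x t ht => ((hu3 t ht).differentiable (by norm_num) x).hasDerivAt
  have hux : ∀ x, ∀ t ∈ Icc 0 τ,
      HasDerivAt (deriv (fun y => u y t)) (u x t - m x t) x := by
    intro x t ht
    have h1 := (hu3 t ht).differentiable_iteratedDeriv 1 (by norm_num)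
    rw [iteratedDeriv_one] at h1
    refine (h1 x).hasDerivAt.congr_deriv ?_
    rw [h.momentum x t (hsub ht), iteratedDeriv_succ, iteratedDeriv_one]; ring
  have hm : ∀ x, ∀ t ∈ Icc 0 τ, HasDerivAt (fun y => m y t) (deriv (fun y => m y t) x) x :=
    fun x t ht => ((hm1 t ht).differentiable (by norm_num) x).hasDerivAt
  have hset : (univ : Set ℝ) ×ˢ Icc 0 τ ⊆ univ ×ˢ Ico 0 T := prod_mono_right hsub
  refine ⟨C, hu, hux, hm, ?_, ?_, ?_, ?_, ?_, fun x t ht => (hC x t ht).1,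
    fun x t ht => (hC x t ht).2⟩
  · intro x t ht
    have htI := Ioo_subset_Icc_self ht
    have hd : DifferentiableAt ℝ (fun s => m x s) t :=
      ((h.regular_m.2.1 x (mem_univ x)).differentiableOn (by norm_num)).differentiableAt
        (Ico_mem_nhds ht.1 (ht.2.trans hτ.2))
    refine hd.hasDerivAt.congr_deriv ?_
    have hflux := ((hasDerivAt_sq_sub_sq (m := fun y => m y t) (hu x t htI) (hux x t htI)).mul
      (hm x t htI)).deriv
    have heq := h.equation x t ⟨ht.1, ht.2.trans hτ.2⟩
    rw [show (fun y => ((u y t) ^ 2 - (deriv (fun z => u z t) y) ^ 2) * m y t)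
      = (fun y => (u y t) ^ 2 - (deriv (fun z => u z t) y) ^ 2) * fun y => m y t from rfl,
      hflux] at heq
    linarith
  · simpa using (h.regular_u.2.2.1 0 (by norm_num)).mono hset
  · simpa [iteratedDerivWithin_univ, iteratedDeriv_one] using
      (h.regular_u.2.2.1 1 (by norm_num)).mono hset
  · simpa using (h.regular_m.2.2.1 0 (by norm_num)).mono hset
  · simpa [iteratedDerivWithin_univ, iteratedDeriv_one] using
      (h.regular_m.2.2.1 1 (by norm_num)).mono hset

theorem eq_of_hasDerivAt_zero_Ioo {f : ℝ → ℝ} {τ t : ℝ} (hc : ContinuousOn f (Icc 0 τ))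
    (hd : ∀ s ∈ Ioo 0 τ, HasDerivAt f 0 s) (ht : t ∈ Icc 0 τ) : f t = f 0 := by
  rcases ht.1.eq_or_lt with rfl | h0
  · rfl
  obtain ⟨c, -, hc'⟩ := exists_hasDerivAt_eq_slope f (fun _ => 0) h0
    (hc.mono (Icc_subset_Icc_right ht.2)) (fun s hs => hd s ⟨hs.1, hs.2.trans_le ht.2⟩)
  have := (div_eq_zero_iff.1 hc'.symm).resolve_right (by linarith)
  linarith

namespace IsStripSolution

variable {u ux m mx : ℝ → ℝ → ℝ} {τ C : ℝ}

theorem continuous_m (h : IsStripSolution u ux m mx τ C) {t : ℝ} (ht : t ∈ Icc 0 τ) :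
    Continuous fun x => m x t :=
  continuous_iff_continuousAt.2 fun x => (h.hasDerivAt_m x t ht).continuousAt

theorem isRegularField (h : IsStripSolution u ux m mx τ C) :
    IsRegularField (fun x t => u x t ^ 2 - ux x t ^ 2) τ (2 * C ^ 2) where
  bound x t ht := by
    have h1 := sq_le_sq.2 ((h.bound_u x t ht).trans (le_abs_self C))
    have h2 := sq_le_sq.2 ((h.bound_ux x t ht).trans (le_abs_self C))
    rw [abs_le]
    constructor <;> nlinarith [sq_nonneg (u x t), sq_nonneg (ux x t)]
  cont x := by
    have hm : MapsTo (fun t : ℝ => (x, t)) (Icc 0 τ) (univ ×ˢ Icc 0 τ) :=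
      fun t ht => ⟨mem_univ _, ht⟩
    have hc : ContinuousOn (fun t : ℝ => (x, t)) (Icc 0 τ) := by fun_prop
    exact ((h.cont_u.comp hc hm).pow 2).sub ((h.cont_ux.comp hc hm).pow 2)
  lip R := by
    have hcomp : IsCompact (Icc (-R) R ×ˢ Icc 0 τ) := isCompact_Icc.prod isCompact_Icc
    obtain ⟨B, hB⟩ := hcomp.exists_bound_of_continuousOn
      (f := fun p : ℝ × ℝ => 2 * ux p.1 p.2 * m p.1 p.2)
      (((continuousOn_const.mul h.cont_ux).mul h.cont_m).mono (prod_mono_left (subset_univ _)))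
    refine ⟨B.toNNReal, fun t ht => ?_⟩
    refine (convex_Icc (-R) R).lipschitzOnWith_of_nnnorm_hasDerivWithin_le
      (fun x _ => (hasDerivAt_sq_sub_sq (m := fun y => m y t) (h.hasDerivAt_u x t ht)
        (h.hasDerivAt_ux x t ht)).hasDerivWithinAt) fun x hx => ?_
    rw [← NNReal.coe_le_coe, coe_nnnorm]
    exact (hB (x, t) ⟨hx, ht⟩).trans (Real.le_coe_toNNReal B)

/-- Along a characteristic the momentum solves a linear equation `h' = -a h`, hence is its initial
value times a positive factor. -/
theorem exists_pos_mul_eq (h : IsStripSolution u ux m mx τ C) {γ : ℝ → ℝ}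
    (hγ : IsCharacteristic (fun x t => u x t ^ 2 - ux x t ^ 2) τ γ) {t : ℝ} (ht : t ∈ Icc 0 τ) :
    ∃ E > 0, m (γ t) t = E * m (γ 0) 0 := by
  have hτ : 0 ≤ τ := ht.1.trans ht.2
  have hmap : MapsTo (fun s : ℝ => (γ s, s)) (Icc 0 τ) (univ ×ˢ Icc 0 τ) :=
    fun s hs => ⟨mem_univ _, hs⟩
  have hcur : ContinuousOn (fun s : ℝ => (γ s, s)) (Icc 0 τ) :=
    hγ.continuousOn.prodMk continuousOn_id
  have hopen : (univ : Set ℝ) ×ˢ Ioo 0 τ ⊆ univ ×ˢ Icc 0 τ := prod_mono_right Ioo_subset_Icc_self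
  have ca : ContinuousOn (fun s => 2 * ux (γ s) s * m (γ s) s) (Icc 0 τ) :=
    ((continuousOn_const.mul h.cont_ux).mul h.cont_m).comp hcur hmap
  -- `a` is extended to all times to have an antiderivative on `ℝ`
  set a : ℝ → ℝ := IccExtend hτ (domRestrict (Icc 0 τ) fun s => 2 * ux (γ s) s * m (γ s) s) with ha
  have hac : Continuous a :=
    continuous_IccExtend_iff.2 (continuousOn_iff_continuous_domRestrict.1 ca)
  have haeq : ∀ s ∈ Icc 0 τ, a s = 2 * ux (γ s) s * m (γ s) s := fun s hs => by
    rw [ha, IccExtend_of_mem _ _ hs]; rfl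
  have hA : ∀ s, HasDerivAt (fun r => ∫ x in (0 : ℝ)..r, a x) (a s) s := fun s =>
    hac.integral_hasStrictDerivAt 0 s |>.hasDerivAt
  have hconst := eq_of_hasDerivAt_zero_Ioo
    (f := fun s => m (γ s) s * Real.exp (∫ x in (0 : ℝ)..s, a x))
    ((h.cont_m.comp hcur hmap).mul (Real.continuous_exp.comp
      (continuous_iff_continuousAt.2 fun s => (hA s).continuousAt)).continuousOn)
    (fun s hs => by
      have hsI := Ioo_subset_Icc_self hs
      have h1 := hasDerivAt_along_curve (F := m) (Fx := mx)
        (fun x r hr => h.hasDerivAt_m x r (Ioo_subset_Icc_self hr)) h.hasDerivAt_time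
        (h.cont_mx.mono hopen)
        ((((((continuousOn_const.mul h.cont_ux).mul h.cont_m).mul h.cont_m).add
          (((h.cont_u.pow 2).sub (h.cont_ux.pow 2)).mul h.cont_mx)).neg).mono hopen)
        hs (hγ.hasDerivAt hs)
      refine (h1.mul (hA s).exp).congr_deriv ?_
      rw [haeq s hsI]; ring) ht
  simp only [intervalIntegral.integral_same, Real.exp_zero, mul_one] at hconst
  refine ⟨Real.exp (-∫ x in (0 : ℝ)..t, a x), Real.exp_pos _, ?_⟩
  rw [← hconst, mul_comm, mul_assoc, ← Real.exp_add, add_neg_cancel, Real.exp_zero, mul_one]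

/-- The flux identity: the time derivative of `∫₀ˣ m(y,t) dy` is the flux at `0` minus the flux
at `x`. -/
theorem hasDerivAt_integral (h : IsStripSolution u ux m mx τ C) (x : ℝ) {t : ℝ}
    (ht : t ∈ Ioo 0 τ) :
    HasDerivAt (fun s => ∫ y in (0 : ℝ)..x, m y s)
      ((u 0 t ^ 2 - ux 0 t ^ 2) * m 0 t - (u x t ^ 2 - ux x t ^ 2) * m x t) t := by
  set mt : ℝ → ℝ → ℝ := fun x t =>
    -(2 * ux x t * m x t * m x t + (u x t ^ 2 - ux x t ^ 2) * mx x t) with hmt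
  have cmt : ContinuousOn (fun p : ℝ × ℝ => mt p.1 p.2) (univ ×ˢ Icc 0 τ) :=
    (((((continuousOn_const.mul h.cont_ux).mul h.cont_m).mul h.cont_m).add
          (((h.cont_u.pow 2).sub (h.cont_ux.pow 2)).mul h.cont_mx)).neg)
  have htI := Ioo_subset_Icc_self ht
  have cmt' : Continuous fun y => mt y t := by
    rw [← continuousOn_univ]
    exact cmt.comp (f := fun y : ℝ => (y, t)) (by fun_prop) fun y _ => ⟨mem_univ _, htI⟩
  obtain ⟨B, hB⟩ := (isCompact_uIcc.prod isCompact_Icc).exists_bound_of_continuousOn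
    (cmt.mono (prod_mono_left (subset_univ (uIcc 0 x))))
  have key := intervalIntegral.hasDerivAt_integral_of_dominated_loc_of_deriv_le (μ := volume)
    (F := fun s y => m y s) (F' := fun s y => mt y s) (x₀ := t) (a := 0) (b := x)
    (bound := fun _ => B) (Ioo_mem_nhds ht.1 ht.2)
    (by
      filter_upwards [Ioo_mem_nhds ht.1 ht.2] with s hs
      exact (h.continuous_m (Ioo_subset_Icc_self hs)).aestronglyMeasurable)
    ((h.continuous_m htI).intervalIntegrable _ _)
    cmt'.aestronglyMeasurable
    (Eventually.of_forall fun y hy s hs =>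
      hB (y, s) ⟨uIoc_subset_uIcc hy, Ioo_subset_Icc_self hs⟩)
    intervalIntegrable_const
    (Eventually.of_forall fun y _ s hs => h.hasDerivAt_time y s hs)
  refine key.2.congr_deriv ?_
  have hflux : ∀ y, HasDerivAt (fun y => -((u y t ^ 2 - ux y t ^ 2) * m y t)) (mt y t) y :=
    fun y => ((hasDerivAt_sq_sub_sq (m := fun y => m y t) (h.hasDerivAt_u y t htI)
      (h.hasDerivAt_ux y t htI)).mul (h.hasDerivAt_m y t htI)).neg
  rw [intervalIntegral.integral_eq_sub_of_hasDerivAt (fun y _ => hflux y)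
    (cmt'.intervalIntegrable _ _)]
  ring

/-- The momentum between two characteristics is conserved. -/
theorem integral_between_eq (h : IsStripSolution u ux m mx τ C) {γ₁ γ₂ : ℝ → ℝ}
    (h₁ : IsCharacteristic (fun x t => u x t ^ 2 - ux x t ^ 2) τ γ₁)
    (h₂ : IsCharacteristic (fun x t => u x t ^ 2 - ux x t ^ 2) τ γ₂) {t : ℝ} (ht : t ∈ Icc 0 τ) :
    ∫ x in (γ₁ t)..(γ₂ t), m x t = ∫ x in (γ₁ 0)..(γ₂ 0), m x 0 := by
  have hτ : 0 ≤ τ := ht.1.trans ht.2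
  have hopen : (univ : Set ℝ) ×ˢ Ioo 0 τ ⊆ univ ×ˢ Icc 0 τ := prod_mono_right Ioo_subset_Icc_self
  have hc : ∀ γ, IsCharacteristic (fun x t => u x t ^ 2 - ux x t ^ 2) τ γ →
      ContinuousOn (fun s => ∫ x in (0 : ℝ)..(γ s), m x s) (Icc 0 τ) := by
    intro γ hγ
    have c1 : Continuous (IccExtend hτ (domRestrict (Icc 0 τ) γ)) :=
      continuous_IccExtend_iff.2 (continuousOn_iff_continuous_domRestrict.1 hγ.continuousOn)
    have c2 : Continuous (Function.uncurry fun s x : ℝ => m x (projIcc 0 τ hτ s)) := by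
      rw [← continuousOn_univ]
      refine h.cont_m.comp (f := fun p : ℝ × ℝ => (p.2, (projIcc 0 τ hτ p.1 : ℝ)))
        (Continuous.continuousOn ?_) fun p _ => ⟨mem_univ _, (projIcc 0 τ hτ p.1).2⟩
      exact continuous_snd.prodMk
        (continuous_subtype_val.comp (continuous_projIcc.comp continuous_fst))
    refine (intervalIntegral.continuous_parametric_intervalIntegral_of_continuous
      (μ := volume) (a₀ := (0 : ℝ)) c2 c1).continuousOn.congr fun s hs => ?_
    simp only [IccExtend_of_mem _ _ hs, projIcc_of_mem _ hs]
    rfl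
  have hd : ∀ γ, IsCharacteristic (fun x t => u x t ^ 2 - ux x t ^ 2) τ γ → ∀ s ∈ Ioo 0 τ,
      HasDerivAt (fun s => ∫ x in (0 : ℝ)..(γ s), m x s)
        ((u 0 s ^ 2 - ux 0 s ^ 2) * m 0 s) s := by
    intro γ hγ s hs
    have cV : ContinuousOn (fun p : ℝ × ℝ => (u p.1 p.2 ^ 2 - ux p.1 p.2 ^ 2) * m p.1 p.2)
        (univ ×ˢ Icc 0 τ) := ((h.cont_u.pow 2).sub (h.cont_ux.pow 2)).mul h.cont_m
    have c0 : ContinuousOn (fun p : ℝ × ℝ => (u 0 p.2 ^ 2 - ux 0 p.2 ^ 2) * m 0 p.2)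
        (univ ×ˢ Icc 0 τ) :=
      cV.comp (f := fun p : ℝ × ℝ => ((0 : ℝ), p.2)) (by fun_prop) fun p hp => ⟨mem_univ _, hp.2⟩
    refine (hasDerivAt_along_curve (F := fun x s => ∫ y in (0 : ℝ)..x, m y s) (Fx := m)
      (fun x r hr => ((h.continuous_m
        (Ioo_subset_Icc_self hr)).integral_hasStrictDerivAt 0 x).hasDerivAt)
      (fun x r hr => h.hasDerivAt_integral x hr) (h.cont_m.mono hopen)
      ((c0.sub cV).mono hopen) hs (hγ.hasDerivAt hs)).congr_deriv ?_
    ring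
  -- both integrals from `0` grow by the flux through `0`, which cancels in the difference
  have hconst := eq_of_hasDerivAt_zero_Ioo
    (f := fun s => (∫ x in (0 : ℝ)..(γ₂ s), m x s) - ∫ x in (0 : ℝ)..(γ₁ s), m x s)
    ((hc γ₂ h₂).sub (hc γ₁ h₁))
    (fun s hs => ((hd γ₂ h₂ s hs).sub (hd γ₁ h₁ s hs)).congr_deriv (sub_self _)) ht
  have hi : ∀ s ∈ Icc 0 τ, ∀ a b, IntervalIntegrable (fun x => m x s) volume a b :=
    fun s hs a b => (h.continuous_m hs).intervalIntegrable a b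
  have h0 : (0 : ℝ) ∈ Icc 0 τ := left_mem_Icc.2 hτ
  rwa [intervalIntegral.integral_interval_sub_left (hi t ht _ _) (hi t ht _ _),
    intervalIntegral.integral_interval_sub_left (hi 0 h0 _ _) (hi 0 h0 _ _)] at hconst

end IsStripSolution

/-! ### Transport of the momentum -/

/-- The flow of `u² - ux²` transports the momentum of a strip solution, whose initial value `m₀`
vanishes outside `(-L, L)`. -/
structure IsTransportedSolution (L : ℝ) (m₀ : ℝ → ℝ) (u ux m mx Y : ℝ → ℝ → ℝ) (τ C : ℝ) :
    Prop where
  sol : IsStripSolution u ux m mx τ C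
  flow : IsFlow (fun x t => u x t ^ 2 - ux x t ^ 2) τ Y
  initial : ∀ x, m x 0 = m₀ x
  zero : ∀ x, L ≤ |x| → m₀ x = 0
  cont : Continuous m₀

namespace IsTransportedSolution

variable {u ux m mx Y : ℝ → ℝ → ℝ} {m₀ : ℝ → ℝ} {L τ C t : ℝ}

theorem exists_pos_mul_eq (h : IsTransportedSolution L m₀ u ux m mx Y τ C) (ht : t ∈ Icc 0 τ)
    (ξ : ℝ) : ∃ E > 0, m (Y ξ t) t = E * m₀ ξ := by
  obtain ⟨E, hE, he⟩ := h.sol.exists_pos_mul_eq (h.flow.char ξ) ht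
  rw [h.flow.initial, h.initial] at he
  exact ⟨E, hE, he⟩

theorem exists_support_bound (h : IsTransportedSolution L m₀ u ux m mx Y τ C) (ht : t ∈ Icc 0 τ) :
    ∃ R, ∀ x, R < |x| → m x t = 0 := by
  refine ⟨L + 2 * C ^ 2 * |t|, fun x hx => ?_⟩
  obtain ⟨ξ, rfl⟩ := h.flow.surjective h.sol.isRegularField ht x
  obtain ⟨E, -, hE⟩ := h.exists_pos_mul_eq ht ξ
  simp only at hx ⊢
  rw [hE, h.zero, mul_zero]
  have := (h.flow.char ξ).abs_sub_le h.sol.isRegularField ht (left_mem_Icc.2 (ht.1.trans ht.2))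
  rw [h.flow.initial, sub_zero] at this
  have h2 := abs_sub_abs_le_abs_sub (Y ξ t) ξ
  linarith

theorem hasCompactSupport (h : IsTransportedSolution L m₀ u ux m mx Y τ C) (ht : t ∈ Icc 0 τ) :
    HasCompactSupport fun x => m x t := by
  obtain ⟨R, hR⟩ := h.exists_support_bound ht
  refine HasCompactSupport.intro (isCompact_Icc (a := -R) (b := R)) fun y hy => hR y ?_
  by_contra hn
  exact hy (abs_le.1 (not_lt.1 hn))

theorem integrable (h : IsTransportedSolution L m₀ u ux m mx Y τ C) (ht : t ∈ Icc 0 τ) :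
    Integrable fun x => m x t :=
  (h.sol.continuous_m ht).integrable_of_hasCompactSupport (h.hasCompactSupport ht)

theorem integrable_initial (h : IsTransportedSolution L m₀ u ux m mx Y τ C) (hτ : 0 ≤ τ) :
    Integrable m₀ := by
  have := h.integrable (left_mem_Icc.2 hτ)
  simpa only [h.initial] using this

/-- The measure `m(·,t) dx` is the push-forward of `m₀ dx` under the flow. -/
theorem integral_mul_eq (h : IsTransportedSolution L m₀ u ux m mx Y τ C) (ht : t ∈ Icc 0 τ)
    {φ : ℝ → ℝ} (mφ : Measurable φ) {B : ℝ} (bφ : ∀ x, |φ x| ≤ B) :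
    ∫ x, φ x * m x t = ∫ θ, φ (Y θ t) * m₀ θ := by
  have hV := h.sol.isRegularField
  have hτ : 0 ≤ τ := ht.1.trans ht.2
  refine integral_mul_eq_of_cdf_eq (h.flow.strictMono hV ht) (h.flow.continuous hV ht)
    (h.flow.surjective hV ht) (h.integrable ht) (h.integrable_initial hτ)
    (h.sol.continuous_m ht).measurable h.cont.measurable (fun ξ => ?_) mφ bφ
  -- to the left of `η` there is no mass, initially or at time `t`
  set η := min ξ (-|L|) with hη
  have z0 : ∫ θ in Iic η, m₀ θ = 0 := by
    refine setIntegral_eq_zero_of_forall_eq_zero fun θ hθ => h.zero θ ?_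
    have : θ ≤ -|L| := le_trans hθ (min_le_right _ _)
    linarith [neg_abs_le θ, le_abs_self L]
  have zt : ∫ x in Iic (Y η t), m x t = 0 := by
    refine setIntegral_eq_zero_of_forall_eq_zero fun x hx => ?_
    obtain ⟨θ, rfl⟩ := h.flow.surjective hV ht x
    obtain ⟨E, -, hE⟩ := h.exists_pos_mul_eq ht θ
    have hθ : θ ≤ η := (h.flow.strictMono hV ht).le_iff_le.1 hx
    simp only
    rw [hE, h.zero, mul_zero]
    have : θ ≤ -|L| := le_trans hθ (min_le_right _ _)
    linarith [neg_abs_le θ, le_abs_self L]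
  have e1 := intervalIntegral.integral_Iic_sub_Iic (a := Y η t) (b := Y ξ t)
    (h.integrable ht).integrableOn (h.integrable ht).integrableOn
  have e2 := intervalIntegral.integral_Iic_sub_Iic (a := η) (b := ξ)
    (h.integrable_initial hτ).integrableOn (h.integrable_initial hτ).integrableOn
  have e3 := h.sol.integral_between_eq (h.flow.char η) (h.flow.char ξ) ht
  simp only [h.flow.initial, h.initial] at e3
  linarith

theorem integral_eq_intervalIntegral (h : IsTransportedSolution L m₀ u ux m mx Y τ C)
    (hL : 0 ≤ L) (g : ℝ → ℝ) : ∫ θ, g θ * m₀ θ = ∫ θ in (-L)..L, g θ * m₀ θ := by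
  rw [intervalIntegral.integral_of_le (by linarith), setIntegral_eq_integral_of_forall_compl_eq_zero]
  intro θ hθ
  rw [h.zero, mul_zero]
  by_contra! hlt
  exact hθ ⟨(abs_lt.1 hlt).1, (abs_lt.1 hlt).2.le⟩

/-- Since `u = G ∗ m` and `u_x = G' ∗ m`, the velocity `u² - u_x²` is the Lagrangian velocity
generated by its own flow. -/
theorem velocity_eq (h : IsTransportedSolution L m₀ u ux m mx Y τ C) (hL : 0 ≤ L)
    (ht : t ∈ Icc 0 τ) (x : ℝ) : u x t ^ 2 - ux x t ^ 2 = lagrangeVelocity L m₀ Y x t := by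
  obtain ⟨R, hR⟩ := h.exists_support_bound ht
  obtain ⟨e1, e2⟩ := eq_integral_helmholtzKernel (fun x => h.sol.hasDerivAt_u x t ht)
    (fun x => h.sol.hasDerivAt_ux x t ht) (m := fun x => m x t) (fun x => by ring)
    (h.sol.continuous_m ht) hR (fun x => h.sol.bound_u x t ht) (fun x => h.sol.bound_ux x t ht) x
  rw [h.integral_mul_eq ht (φ := fun y => helmholtzKernel (x - y))
    (measurable_helmholtzKernel.comp (measurable_const.sub measurable_id))
    (fun y => abs_helmholtzKernel_le _), h.integral_eq_intervalIntegral hL] at e1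
  rw [h.integral_mul_eq ht (φ := fun y => helmholtzKernel' (x - y))
    (measurable_helmholtzKernel'.comp (measurable_const.sub measurable_id))
    (fun y => abs_helmholtzKernel'_le _), h.integral_eq_intervalIntegral hL] at e2
  rw [lagrangeVelocity, e1, e2]

theorem integral_abs_eq (h : IsTransportedSolution L m₀ u ux m mx Y τ C) (hL : 0 ≤ L)
    (ht : t ∈ Icc 0 τ) : ∫ x, |m x t| = ∫ θ in (-L)..L, |m₀ θ| := by
  -- test the push-forward identity with the sign of `m(·,t)`, which is transported by the flow
  have e := h.integral_mul_eq ht (φ := fun x => Real.sign (m x t))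
    (measurable_sign.comp (h.sol.continuous_m ht).measurable) (B := 1) (fun x => by
      rcases Real.sign_apply_eq (m x t) with h | h | h <;> rw [h] <;> norm_num)
  rw [h.integral_eq_intervalIntegral hL] at e
  have hs : ∀ θ, Real.sign (m (Y θ t) t) * m₀ θ = |m₀ θ| := fun θ => by
    obtain ⟨E, hE, he⟩ := h.exists_pos_mul_eq ht θ
    rw [he, sign_pos_mul hE, sign_mul_self_eq_abs]
  simpa only [sign_mul_self_eq_abs, hs] using e

end IsTransportedSolution

/-! ### Uniqueness for the Lagrange dynamics -/

/-- `X` is a jointly continuous solution of the Lagrange dynamics on `[-L, L] × [0, τ]`, with no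
regularity in the label `ξ` beyond continuity. -/
structure IsLagrangeStrip (L : ℝ) (m₀ : ℝ → ℝ) (τ : ℝ) (X : ℝ → ℝ → ℝ) : Prop where
  cont : ContinuousOn (fun p : ℝ × ℝ => X p.1 p.2) (Icc (-L) L ×ˢ Icc 0 τ)
  initial : ∀ ξ ∈ Icc (-L) L, X ξ 0 = ξ
  dynamics : ∀ ξ ∈ Icc (-L) L, ∀ t ∈ Ioo 0 τ,
    HasDerivAt (fun s => X ξ s) (lagrangeVelocity L m₀ X (X ξ t) t) t

theorem intervalIntegrable_kernel_mul {L : ℝ} {k x m₀ : ℝ → ℝ} (hL : 0 ≤ L)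
    (mk : Measurable k) (bk : ∀ z, |k z| ≤ 1 / 2) (cx : ContinuousOn x (Icc (-L) L))
    (cm : Continuous m₀) (a : ℝ) :
    IntervalIntegrable (fun θ => k (a - x θ) * m₀ θ) volume (-L) L := by
  rw [intervalIntegrable_iff_integrableOn_Icc_of_le (by linarith)]
  have mx : AEMeasurable x (volume.restrict (Icc (-L) L)) := cx.aemeasurable measurableSet_Icc
  exact (cm.integrableOn_Icc (μ := volume)).bdd_mul
    (mk.comp_aemeasurable (aemeasurable_const.sub mx)).aestronglyMeasurable
    (Eventually.of_forall fun θ => by simpa using bk (a - x θ))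

theorem abs_integral_kernel_mul_le {L M : ℝ} {k x m₀ : ℝ → ℝ} (hL : 0 ≤ L)
    (bk : ∀ z, |k z| ≤ 1 / 2) (hM : ∀ θ, |m₀ θ| ≤ M) (a : ℝ) :
    |∫ θ in (-L)..L, k (a - x θ) * m₀ θ| ≤ L * M := by
  have := intervalIntegral.norm_integral_le_of_norm_le_const (a := -L) (b := L)
    (f := fun θ => k (a - x θ) * m₀ θ) (C := 1 / 2 * M) (fun θ _ => by
      rw [Real.norm_eq_abs, abs_mul]
      exact mul_le_mul (bk _) (hM θ) (abs_nonneg _) (by norm_num))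
  rw [Real.norm_eq_abs, abs_of_nonneg (show (0 : ℝ) ≤ L - -L by linarith)] at this
  linarith

/-- Stability of the Lagrangian velocity. The kernel `G'` jumps, but the labels `θ` for which
`x ξ - x θ` and `y ξ - y θ` may lie on different sides of the jump satisfy `|ξ - θ| ≤ 2 C D`,
because `y` does not contract distances by more than the factor `C`. -/
theorem abs_lagrangeVelocity_sub_le {L M C D t : ℝ} {m₀ : ℝ → ℝ} {X Y : ℝ → ℝ → ℝ} (hL : 0 ≤ L)
    (cm : Continuous m₀) (hM : ∀ θ, |m₀ θ| ≤ M) (hC : 0 ≤ C)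
    (cX : ContinuousOn (fun θ => X θ t) (Icc (-L) L))
    (cY : ContinuousOn (fun θ => Y θ t) (Icc (-L) L))
    (hY : ∀ ξ ∈ Icc (-L) L, ∀ η ∈ Icc (-L) L, |ξ - η| ≤ C * |Y ξ t - Y η t|)
    (hD : ∀ θ ∈ Icc (-L) L, |X θ t - Y θ t| ≤ D) {ξ : ℝ} (hξ : ξ ∈ Icc (-L) L) :
    |lagrangeVelocity L m₀ X (X ξ t) t - lagrangeVelocity L m₀ Y (Y ξ t) t|
      ≤ 2 * L * M ^ 2 * (8 * L + 4 * C) * D := by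
  have hD0 : 0 ≤ D := (abs_nonneg _).trans (hD ξ hξ)
  have hM0 : 0 ≤ M := (abs_nonneg _).trans (hM 0)
  have hle : -L ≤ L := by linarith
  have hdiff : ∀ θ ∈ Icc (-L) L, |(X ξ t - X θ t) - (Y ξ t - Y θ t)| ≤ 2 * D := by
    intro θ hθ
    have h1 := abs_le.1 (hD ξ hξ)
    have h2 := abs_le.1 (hD θ hθ)
    rw [abs_le]
    constructor <;> linarith [h1.1, h1.2, h2.1, h2.2]
  have hA : |(∫ θ in (-L)..L, helmholtzKernel (X ξ t - X θ t) * m₀ θ)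
      - ∫ θ in (-L)..L, helmholtzKernel (Y ξ t - Y θ t) * m₀ θ| ≤ 4 * L * M * D := by
    rw [← intervalIntegral.integral_sub
      (intervalIntegrable_kernel_mul hL measurable_helmholtzKernel abs_helmholtzKernel_le cX cm _)
      (intervalIntegrable_kernel_mul hL measurable_helmholtzKernel abs_helmholtzKernel_le cY cm _)]
    have := intervalIntegral.norm_integral_le_of_norm_le_const (a := -L) (b := L)
      (f := fun θ => helmholtzKernel (X ξ t - X θ t) * m₀ θ
        - helmholtzKernel (Y ξ t - Y θ t) * m₀ θ) (C := 2 * D * M) (fun θ hθ => by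
        rw [uIoc_of_le hle] at hθ
        rw [← sub_mul, Real.norm_eq_abs, abs_mul]
        exact mul_le_mul ((abs_helmholtzKernel_sub_le _ _).trans
          (hdiff θ (Ioc_subset_Icc_self hθ))) (hM θ) (abs_nonneg _) (by linarith))
    rw [Real.norm_eq_abs, abs_of_nonneg (show (0 : ℝ) ≤ L - -L by linarith)] at this
    linarith
  have hB : |(∫ θ in (-L)..L, helmholtzKernel' (X ξ t - X θ t) * m₀ θ)
      - ∫ θ in (-L)..L, helmholtzKernel' (Y ξ t - Y θ t) * m₀ θ| ≤ (4 * L + 4 * C) * M * D := by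
    rw [← intervalIntegral.integral_sub
      (intervalIntegrable_kernel_mul hL measurable_helmholtzKernel' abs_helmholtzKernel'_le cX cm _)
      (intervalIntegrable_kernel_mul hL measurable_helmholtzKernel' abs_helmholtzKernel'_le
        cY cm _)]
    -- outside the label window `S` both arguments of `G'` lie on the same side of the jump
    set S : Set ℝ := Icc (ξ - 2 * C * D) (ξ + 2 * C * D) with hS
    have iS : Integrable (S.indicator fun _ : ℝ => M) :=
      (integrable_indicator_iff measurableSet_Icc).2 (integrableOn_const (by simp))
    have hpt : ∀ θ ∈ Ioc (-L) L, ‖helmholtzKernel' (X ξ t - X θ t) * m₀ θ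
        - helmholtzKernel' (Y ξ t - Y θ t) * m₀ θ‖ ≤ 2 * D * M + S.indicator (fun _ => M) θ := by
      intro θ hθ
      have hθ' := Ioc_subset_Icc_self hθ
      rw [← sub_mul, Real.norm_eq_abs, abs_mul]
      rcases lt_or_ge (2 * D) |Y ξ t - Y θ t| with hlt | hge
      · have h1 := (abs_helmholtzKernel'_sub_le ((hdiff θ hθ').trans_lt hlt)).trans (hdiff θ hθ')
        have h2 : 0 ≤ S.indicator (fun _ => M) θ := indicator_nonneg (fun _ _ => hM0) θ
        have := mul_le_mul h1 (hM θ) (abs_nonneg _) (by linarith)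
        linarith
      · have h1 : θ ∈ S := by
          have := (hY ξ hξ θ hθ').trans (mul_le_mul_of_nonneg_left hge hC)
          rw [abs_le] at this
          constructor <;> linarith [this.1, this.2]
        rw [indicator_of_mem h1]
        have h2 : |helmholtzKernel' (X ξ t - X θ t) - helmholtzKernel' (Y ξ t - Y θ t)| ≤ 1 := by
          have := abs_sub (helmholtzKernel' (X ξ t - X θ t)) (helmholtzKernel' (Y ξ t - Y θ t))
          linarith [abs_helmholtzKernel'_le (X ξ t - X θ t),
            abs_helmholtzKernel'_le (Y ξ t - Y θ t)]
        have := mul_le_mul h2 (hM θ) (abs_nonneg _) zero_le_one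
        have : 0 ≤ 2 * D * M := by positivity
        linarith
    have h1 := intervalIntegral.norm_integral_le_of_norm_le hle
      (Eventually.of_forall hpt) (intervalIntegrable_const.add iS.intervalIntegrable)
    rw [Real.norm_eq_abs, intervalIntegral.integral_add intervalIntegrable_const
      iS.intervalIntegrable, intervalIntegral.integral_const] at h1
    have h2 : ∫ θ in (-L)..L, S.indicator (fun _ => M) θ ≤ 4 * C * D * M := by
      rw [intervalIntegral.integral_of_le hle]
      refine (setIntegral_le_integral iS
        (Eventually.of_forall fun θ => indicator_nonneg (fun _ _ => hM0) θ)).trans ?_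
      rw [integral_indicator measurableSet_Icc, setIntegral_const, Real.volume_real_Icc_of_le
        (by nlinarith [mul_nonneg hC hD0]), smul_eq_mul]
      linarith
    rw [smul_eq_mul] at h1
    linarith
  have sq : ∀ a b c : ℝ, |a| ≤ L * M → |b| ≤ L * M → |a - b| ≤ c →
      |a ^ 2 - b ^ 2| ≤ 2 * (L * M) * c := by
    intro a b c ha hb hc
    rw [sq_sub_sq, abs_mul]
    exact mul_le_mul (by linarith [abs_add_le a b]) hc (abs_nonneg _) (by positivity)
  have s1 := sq _ _ _ (abs_integral_kernel_mul_le hL abs_helmholtzKernel_le hM _)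
    (abs_integral_kernel_mul_le hL abs_helmholtzKernel_le hM _) hA
  have s2 := sq _ _ _ (abs_integral_kernel_mul_le hL abs_helmholtzKernel'_le hM _)
    (abs_integral_kernel_mul_le hL abs_helmholtzKernel'_le hM _) hB
  simp only [lagrangeVelocity]
  rw [abs_le] at s1 s2 ⊢
  constructor <;> nlinarith [s1.1, s1.2, s2.1, s2.2]

/-- Uniqueness for the Lagrange dynamics, by a maximum argument for `e^{-λt} |X - Y|`: at a
maximum point with value `N`, integrating `|∂ₜ(X - Y)| ≤ (λ/2) N e^{λt}` gives `N ≤ N / 2`. -/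
theorem IsLagrangeStrip.eq {L τ C : ℝ} {m₀ : ℝ → ℝ} {X Y : ℝ → ℝ → ℝ}
    (hX : IsLagrangeStrip L m₀ τ X) (hY : IsLagrangeStrip L m₀ τ Y) (hL : 0 ≤ L) (hτ : 0 ≤ τ)
    (cm : Continuous m₀) (bm : ∃ M, ∀ θ, |m₀ θ| ≤ M) (hC : 0 ≤ C)
    (hlow : ∀ ξ ∈ Icc (-L) L, ∀ η ∈ Icc (-L) L, ∀ t ∈ Icc 0 τ, |ξ - η| ≤ C * |Y ξ t - Y η t|)
    {ξ t : ℝ} (hξ : ξ ∈ Icc (-L) L) (ht : t ∈ Icc 0 τ) : X ξ t = Y ξ t := by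
  obtain ⟨M, hM⟩ := bm
  set Λ := 2 * L * M ^ 2 * (8 * L + 4 * C) with hΛ
  obtain ⟨⟨ζ, r⟩, ⟨hζ, hr⟩, hmax⟩ := (isCompact_Icc.prod isCompact_Icc).exists_isMaxOn
    (s := Icc (-L) L ×ˢ Icc 0 τ) ⟨(ξ, t), hξ, ht⟩
    (f := fun p : ℝ × ℝ => Real.exp (-(2 * Λ * p.2)) * |X p.1 p.2 - Y p.1 p.2|)
    (ContinuousOn.mul (by fun_prop) (hX.cont.sub hY.cont).abs)
  simp only at hζ hr
  set N := Real.exp (-(2 * Λ * r)) * |X ζ r - Y ζ r| with hN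
  have hbound : ∀ θ ∈ Icc (-L) L, ∀ s ∈ Icc 0 τ, |X θ s - Y θ s| ≤ N * Real.exp (2 * Λ * s) := by
    intro θ hθ s hs
    have h1 : Real.exp (-(2 * Λ * s)) * |X θ s - Y θ s| ≤ N :=
      hmax (show ((θ, s) : ℝ × ℝ) ∈ _ from ⟨hθ, hs⟩)
    rwa [Real.exp_neg, inv_mul_le_iff₀ (Real.exp_pos _), mul_comm] at h1
  have cslice : ∀ Z : ℝ → ℝ → ℝ, IsLagrangeStrip L m₀ τ Z → ∀ s ∈ Icc 0 τ,
      ContinuousOn (fun θ => Z θ s) (Icc (-L) L) := fun Z hZ s hs =>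
    hZ.cont.comp (f := fun θ : ℝ => (θ, s)) (by fun_prop) fun θ hθ => ⟨hθ, hs⟩
  have ctime : ∀ Z : ℝ → ℝ → ℝ, IsLagrangeStrip L m₀ τ Z →
      ContinuousOn (fun s => Z ζ s) (Icc 0 τ) := fun Z hZ =>
    hZ.cont.comp (f := fun s : ℝ => (ζ, s)) (by fun_prop) fun s hs => ⟨hζ, hs⟩
  have hvel : ∀ s ∈ Ioo 0 τ,
      |lagrangeVelocity L m₀ X (X ζ s) s - lagrangeVelocity L m₀ Y (Y ζ s) s|
        ≤ Λ * (N * Real.exp (2 * Λ * s)) := by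
    intro s hs
    have hs' := Ioo_subset_Icc_self hs
    exact abs_lagrangeVelocity_sub_le hL cm hM hC (cslice X hX s hs') (cslice Y hY s hs')
      (fun ξ hξ η hη => hlow ξ hξ η hη s hs') (fun θ hθ => hbound θ hθ s hs') hζ
  have hE : ∀ s, HasDerivAt (fun s : ℝ => N / 2 * Real.exp (2 * Λ * s))
      (Λ * (N * Real.exp (2 * Λ * s))) s := by
    intro s
    have e := (((hasDerivAt_id s).const_mul (2 * Λ)).exp).const_mul (N / 2)
    refine e.congr_deriv ?_
    simp only [id]; ring
  -- used with `σ = ±1`: the primitive of the bound dominates `±(X - Y)` at the label `ζ`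
  have hmono : ∀ σ : ℝ, |σ| ≤ 1 →
      MonotoneOn (fun s => N / 2 * Real.exp (2 * Λ * s) + σ * (X ζ s - Y ζ s)) (Icc 0 τ) := by
    intro σ hσ
    have hd : ∀ s ∈ Ioo 0 τ, HasDerivAt
        (fun s => N / 2 * Real.exp (2 * Λ * s) + σ * (X ζ s - Y ζ s))
        (Λ * (N * Real.exp (2 * Λ * s)) + σ * (lagrangeVelocity L m₀ X (X ζ s) s
          - lagrangeVelocity L m₀ Y (Y ζ s) s)) s := fun s hs =>
      (hE s).add (((hX.dynamics ζ hζ s hs).sub (hY.dynamics ζ hζ s hs)).const_mul σ)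
    refine monotoneOn_of_deriv_nonneg (convex_Icc 0 τ) ?_ ?_ ?_
    · exact ContinuousOn.add (by fun_prop)
        (continuousOn_const.mul ((ctime X hX).sub (ctime Y hY)))
    · rw [interior_Icc]
      exact fun s hs => (hd s hs).differentiableAt.differentiableWithinAt
    · rw [interior_Icc]
      intro s hs
      rw [(hd s hs).deriv]
      have h1 := hvel s hs
      have h2 : |σ * (lagrangeVelocity L m₀ X (X ζ s) s - lagrangeVelocity L m₀ Y (Y ζ s) s)|
          ≤ Λ * (N * Real.exp (2 * Λ * s)) := by
        rw [abs_mul]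
        nlinarith [abs_nonneg (lagrangeVelocity L m₀ X (X ζ s) s
          - lagrangeVelocity L m₀ Y (Y ζ s) s)]
      linarith [(abs_le.1 h2).1]
  have hN0 : 0 ≤ N := by positivity
  have h0 : (0 : ℝ) ∈ Icc 0 τ := left_mem_Icc.2 hτ
  have hp := hmono 1 (by simp) h0 hr hr.1
  have hm := hmono (-1) (by simp) h0 hr hr.1
  simp only [hX.initial ζ hζ, hY.initial ζ hζ, mul_zero, Real.exp_zero, sub_self] at hp hm
  have habs : |X ζ r - Y ζ r| ≤ N / 2 * Real.exp (2 * Λ * r) :=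
    abs_le.2 ⟨by linarith, by linarith⟩
  have hNle : N ≤ N / 2 := by
    calc N ≤ Real.exp (-(2 * Λ * r)) * (N / 2 * Real.exp (2 * Λ * r)) :=
          mul_le_mul_of_nonneg_left habs (Real.exp_pos _).le
      _ = N / 2 := by rw [Real.exp_neg]; field_simp
  have hNz : N = 0 := by linarith
  have := hbound ξ hξ t ht
  rw [hNz, zero_mul] at this
  exact sub_eq_zero.1 (abs_nonpos_iff.1 this)

/-! ### The Lagrange flow of a classical solution -/

theorem IsLagrangeFlow.isLagrangeStrip {L T τ : ℝ} {m₀ : ℝ → ℝ} {X : ℝ → ℝ → ℝ}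
    (hX : IsLagrangeFlow L m₀ T X) (hτ : τ < T) : IsLagrangeStrip L m₀ τ X where
  cont := by
    have := hX.regular.2.2.1 0 (by norm_num)
    simp only [iteratedDerivWithin_zero] at this
    exact this.mono (prod_mono_right fun t ht => ⟨ht.1, ht.2.trans_lt hτ⟩)
  initial := hX.initial
  dynamics ξ hξ t ht := hX.dynamics ξ hξ t ⟨ht.1, ht.2.trans hτ⟩

/-- Up to any time before `T`, the Lagrange flow `X` is the flow of the velocity field `u² - u_x²`
of the classical solution, restricted to `[-L, L]`. -/
theorem IsLagrangeFlow.exists_isTransportedSolution {L T τ : ℝ} {m₀ : ℝ → ℝ} {u m X : ℝ → ℝ → ℝ}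
    (hL : 0 ≤ L) (hX : IsLagrangeFlow L m₀ T X) (hsol : IsClassicalSolution m₀ T u m)
    (cm : Continuous m₀) (bm : ∃ M, ∀ θ, |m₀ θ| ≤ M) (zm : ∀ x, L ≤ |x| → m₀ x = 0)
    (hτ : τ ∈ Ico 0 T) :
    ∃ (ux mx Y : ℝ → ℝ → ℝ) (C : ℝ), IsTransportedSolution L m₀ u ux m mx Y τ C ∧
      ∀ ξ ∈ Icc (-L) L, ∀ t ∈ Icc 0 τ, X ξ t = Y ξ t := by
  obtain ⟨C, hC⟩ := hsol.exists_isStripSolution hτ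
  have hV := hC.isRegularField
  obtain ⟨Y, hY⟩ := hV.exists_isFlow hτ.1
  have htr : IsTransportedSolution L m₀ u _ m _ Y τ C := ⟨hC, hY, hsol.initial, zm, cm⟩
  obtain ⟨B, hB, hlip⟩ := hY.exists_abs_sub_le hV hτ.1 L
  have hYs : IsLagrangeStrip L m₀ τ Y :=
    { cont := hY.continuousOn_uncurry hV hτ.1 L
      initial := fun ξ _ => hY.initial ξ
      dynamics := fun ξ _ t ht => by
        rw [← htr.velocity_eq hL (Ioo_subset_Icc_self ht)]
        exact (hY.char ξ).hasDerivAt ht }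
  exact ⟨_, _, Y, C, htr, fun ξ hξ t ht => (hX.isLagrangeStrip hτ.2).eq hYs hL hτ.1 cm bm hB.le
    (fun ξ hξ η hη t ht => (hlip ξ η (abs_le.2 hξ) (abs_le.2 hη) t ht).2) hξ ht⟩

/-! ### Factorization of the velocity -/

/-- The mass to the left of the label `ξ`, weighted by `e^{x(θ) - x(ξ)}`. At the particle `x(ξ)`
it equals `u - u_x`. -/
noncomputable def leftPotential (L : ℝ) (m₀ x : ℝ → ℝ) (ξ : ℝ) : ℝ :=
  ∫ θ in (-L)..ξ, Real.exp (x θ - x ξ) * m₀ θ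

/-- The mass to the right of the label `ξ`, weighted by `e^{x(ξ) - x(θ)}`. At the particle `x(ξ)`
it equals `u + u_x`. -/
noncomputable def rightPotential (L : ℝ) (m₀ x : ℝ → ℝ) (ξ : ℝ) : ℝ :=
  ∫ θ in ξ..L, Real.exp (x ξ - x θ) * m₀ θ

section Potentials

variable {L M t : ℝ} {m₀ : ℝ → ℝ} {X : ℝ → ℝ → ℝ}

theorem intervalIntegrable_of_mem_Icc {f : ℝ → ℝ} {a b L : ℝ} (hf : ContinuousOn f (Icc (-L) L))
    (ha : a ∈ Icc (-L) L) (hb : b ∈ Icc (-L) L) : IntervalIntegrable f volume a b :=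
  (hf.mono (uIcc_subset_Icc ha hb)).intervalIntegrable

/-- For ordered particles the velocity `u² - u_x²` factors as `(u - u_x)(u + u_x)`. -/
theorem lagrangeVelocity_eq_mul (hL : 0 ≤ L) (cm : Continuous m₀)
    (cX : ContinuousOn (fun θ => X θ t) (Icc (-L) L))
    (hX : StrictMonoOn (fun θ => X θ t) (Icc (-L) L)) {ξ : ℝ} (hξ : ξ ∈ Icc (-L) L) :
    lagrangeVelocity L m₀ X (X ξ t) t
      = leftPotential L m₀ (fun θ => X θ t) ξ * rightPotential L m₀ (fun θ => X θ t) ξ := by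
  have hne : ∀ᵐ θ : ℝ, θ ≠ ξ := compl_mem_ae_iff.2 (measure_singleton ξ)
  have split : ∀ k : ℝ → ℝ, Measurable k → (∀ z, |k z| ≤ 1 / 2) → ∀ c d : ℝ,
      (∀ z > 0, k z = c * Real.exp (-z)) → (∀ z < 0, k z = d * Real.exp z) →
      ∫ θ in (-L)..L, k (X ξ t - X θ t) * m₀ θ
        = c * leftPotential L m₀ (fun θ => X θ t) ξ
          + d * rightPotential L m₀ (fun θ => X θ t) ξ := by
    intro k mk bk c d hc hd
    have hi := intervalIntegrable_kernel_mul hL mk bk cX cm (X ξ t)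
    rw [← intervalIntegral.integral_add_adjacent_intervals (b := ξ)
      (hi.mono_set (by rw [uIcc_of_le hξ.1, uIcc_of_le (by linarith)]
                       exact Icc_subset_Icc_right hξ.2))
      (hi.mono_set (by rw [uIcc_of_le hξ.2, uIcc_of_le (by linarith)]
                       exact Icc_subset_Icc_left hξ.1)),
      leftPotential, rightPotential, ← intervalIntegral.integral_const_mul,
      ← intervalIntegral.integral_const_mul]
    congr 1
    · refine intervalIntegral.integral_congr_ae ?_
      filter_upwards [hne] with θ hθ hmem
      rw [uIoc_of_le hξ.1] at hmem
      have hlt := hX ⟨hmem.1.le, hmem.2.trans hξ.2⟩ hξ (lt_of_le_of_ne hmem.2 hθ)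
      simp only at hlt
      rw [hc _ (by linarith), neg_sub, mul_assoc]
    · refine intervalIntegral.integral_congr_ae ?_
      filter_upwards with θ hmem
      rw [uIoc_of_le hξ.2] at hmem
      have hlt := hX hξ ⟨hξ.1.trans hmem.1.le, hmem.2⟩ hmem.1
      simp only at hlt
      rw [hd _ (by linarith), mul_assoc]
  rw [lagrangeVelocity, split _ measurable_helmholtzKernel abs_helmholtzKernel_le (1 / 2) (1 / 2)
      (fun z hz => by rw [helmholtzKernel_of_nonneg hz.lt.le]; ring)
      (fun z hz => by rw [helmholtzKernel_of_nonpos hz.le]; ring),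
    split _ measurable_helmholtzKernel' abs_helmholtzKernel'_le (-1 / 2) (1 / 2)
      (fun z hz => by rw [helmholtzKernel'_of_pos hz]; ring)
      (fun z hz => by rw [helmholtzKernel'_of_neg hz]; ring)]
  ring

theorem abs_integral_weight_le {a b : ℝ} {w : ℝ → ℝ} (hab : a ≤ b) (cm : Continuous m₀)
    (hw : ∀ θ ∈ Ioc a b, |w θ| ≤ 1) : |∫ θ in a..b, w θ * m₀ θ| ≤ ∫ θ in a..b, |m₀ θ| := by
  refine intervalIntegral.norm_integral_le_of_norm_le (μ := volume)
    (f := fun θ => w θ * m₀ θ) (g := fun θ => |m₀ θ|) hab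
    (Eventually.of_forall fun θ hθ => ?_) (cm.abs.intervalIntegrable _ _)
  rw [Real.norm_eq_abs, abs_mul]
  exact mul_le_of_le_one_left (abs_nonneg _) (hw θ hθ)

theorem integral_abs_le {a b : ℝ} (hM : ∀ θ, |m₀ θ| ≤ M) (hab : a ≤ b) :
    ∫ θ in a..b, |m₀ θ| ≤ M * (b - a) := by
  have := intervalIntegral.norm_integral_le_of_norm_le_const (a := a) (b := b)
    (f := fun θ => |m₀ θ|) (C := M) (fun θ _ => by simpa using hM θ)
  rw [abs_of_nonneg (sub_nonneg.2 hab)] at this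
  exact (le_abs_self _).trans this

theorem abs_exp_sub_le_one {x : ℝ → ℝ} {a b : ℝ} (hx : MonotoneOn x (Icc (-L) L))
    (ha : a ∈ Icc (-L) L) (hb : b ∈ Icc (-L) L) (hab : a ≤ b) : |Real.exp (x a - x b)| ≤ 1 := by
  rw [Real.abs_exp, Real.exp_le_one_iff]
  linarith [hx ha hb hab]

/-- The velocities at two labels differ by at most a multiple of the mass between them: with
`P₂ = e^{-d} P₁ + p` and `Q₁ = e^{-d} Q₂ + q`, where `p` and `q` only involve the labels in
between, `P₂ Q₂ - P₁ Q₁ = p Q₂ - P₁ q`. -/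
theorem abs_lagrangeVelocity_label_sub_le (hL : 0 ≤ L) (cm : Continuous m₀)
    (hM : ∀ θ, |m₀ θ| ≤ M) (cX : ContinuousOn (fun θ => X θ t) (Icc (-L) L))
    (hX : StrictMonoOn (fun θ => X θ t) (Icc (-L) L)) {ξ η : ℝ} (hξ : ξ ∈ Icc (-L) L)
    (hη : η ∈ Icc (-L) L) (h : ξ ≤ η) :
    |lagrangeVelocity L m₀ X (X η t) t - lagrangeVelocity L m₀ X (X ξ t) t|
      ≤ 4 * L * M * ∫ θ in ξ..η, |m₀ θ| := by
  have hM0 : 0 ≤ M := (abs_nonneg _).trans (hM 0)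
  have hl : -L ∈ Icc (-L) L := ⟨le_rfl, by linarith⟩
  have hr : L ∈ Icc (-L) L := ⟨by linarith, le_rfl⟩
  set x : ℝ → ℝ := fun θ => X θ t with hx
  have hmono := hX.monotoneOn
  rw [lagrangeVelocity_eq_mul hL cm cX hX hξ, lagrangeVelocity_eq_mul hL cm cX hX hη, ← hx]
  set p := ∫ θ in ξ..η, Real.exp (x θ - x η) * m₀ θ with hp
  set q := ∫ θ in ξ..η, Real.exp (x ξ - x θ) * m₀ θ with hq
  have cw : ∀ c, ContinuousOn (fun θ => Real.exp (x θ - c) * m₀ θ) (Icc (-L) L) := fun c =>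
    (Real.continuous_exp.comp_continuousOn (cX.sub continuousOn_const)).mul cm.continuousOn
  have cw' : ∀ c, ContinuousOn (fun θ => Real.exp (c - x θ) * m₀ θ) (Icc (-L) L) := fun c =>
    (Real.continuous_exp.comp_continuousOn (continuousOn_const.sub cX)).mul cm.continuousOn
  have eP : leftPotential L m₀ x η = Real.exp (x ξ - x η) * leftPotential L m₀ x ξ + p := by
    rw [leftPotential, leftPotential, ← intervalIntegral.integral_add_adjacent_intervals
      (intervalIntegrable_of_mem_Icc (cw _) hl hξ) (intervalIntegrable_of_mem_Icc (cw _) hξ hη),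
      ← intervalIntegral.integral_const_mul]
    congr 2
    ext θ
    rw [← mul_assoc, ← Real.exp_add]
    ring_nf
  have eQ : rightPotential L m₀ x ξ = Real.exp (x ξ - x η) * rightPotential L m₀ x η + q := by
    rw [rightPotential, rightPotential, ← intervalIntegral.integral_add_adjacent_intervals
      (intervalIntegrable_of_mem_Icc (cw' _) hξ hη) (intervalIntegrable_of_mem_Icc (cw' _) hη hr),
      ← intervalIntegral.integral_const_mul, add_comm]
    congr 2
    ext θ
    rw [← mul_assoc, ← Real.exp_add]
    ring_nf
  have bP : |leftPotential L m₀ x ξ| ≤ M * (2 * L) :=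
    ((abs_integral_weight_le hξ.1 cm fun θ hθ =>
      abs_exp_sub_le_one hmono ⟨hθ.1.le, hθ.2.trans hξ.2⟩ hξ hθ.2).trans
      (integral_abs_le hM hξ.1)).trans (mul_le_mul_of_nonneg_left (by linarith [hξ.2]) hM0)
  have bQ : |rightPotential L m₀ x η| ≤ M * (2 * L) :=
    ((abs_integral_weight_le hη.2 cm fun θ hθ =>
      abs_exp_sub_le_one hmono hη ⟨hη.1.trans hθ.1.le, hθ.2⟩ hθ.1.le).trans
      (integral_abs_le hM hη.2)).trans (mul_le_mul_of_nonneg_left (by linarith [hη.1]) hM0)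
  have bp : |p| ≤ ∫ θ in ξ..η, |m₀ θ| := abs_integral_weight_le h cm fun θ hθ =>
    abs_exp_sub_le_one hmono ⟨hξ.1.trans hθ.1.le, hθ.2.trans hη.2⟩ hη hθ.2
  have bq : |q| ≤ ∫ θ in ξ..η, |m₀ θ| := abs_integral_weight_le h cm fun θ hθ =>
    abs_exp_sub_le_one hmono hξ ⟨hξ.1.trans hθ.1.le, hθ.2.trans hη.2⟩ hθ.1.le
  have e : leftPotential L m₀ x η * rightPotential L m₀ x η
      - leftPotential L m₀ x ξ * rightPotential L m₀ x ξ
      = p * rightPotential L m₀ x η - leftPotential L m₀ x ξ * q := by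
    rw [eP, eQ]; ring
  rw [e]
  refine (abs_sub _ _).trans ?_
  rw [abs_mul, abs_mul]
  have h1 := mul_le_mul bp bQ (abs_nonneg _) ((abs_nonneg _).trans bp)
  have h2 := mul_le_mul bP bq (abs_nonneg _) (by positivity)
  linarith

end Potentials

namespace IsLagrangeFlow

variable {L T M : ℝ} {m₀ : ℝ → ℝ} {X : ℝ → ℝ → ℝ}

theorem continuousOn_label (hX : IsLagrangeFlow L m₀ T X) {t : ℝ} (ht : t ∈ Ico 0 T) :
    ContinuousOn (fun θ => X θ t) (Icc (-L) L) :=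
  (hX.regular.1 t ht).continuousOn

theorem continuousOn_time (hX : IsLagrangeFlow L m₀ T X) {ξ : ℝ} (hξ : ξ ∈ Icc (-L) L) :
    ContinuousOn (fun t => X ξ t) (Ico 0 T) :=
  (hX.regular.2.1 ξ hξ).continuousOn

/-- The end points of `[-L, L]` do not move: one of the two potentials vanishes there. -/
theorem eq_of_endpoint (hX : IsLagrangeFlow L m₀ T X) (hL : 0 ≤ L) (cm : Continuous m₀)
    (hmono : ∀ t ∈ Ico 0 T, StrictMonoOn (fun θ => X θ t) (Icc (-L) L)) {ξ : ℝ}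
    (hξ : ξ = -L ∨ ξ = L) {t : ℝ} (ht : t ∈ Ico 0 T) : X ξ t = ξ := by
  have hmem : ξ ∈ Icc (-L) L := by
    rcases hξ with rfl | rfl <;> constructor <;> linarith
  have hsub : Icc 0 t ⊆ Ico 0 T := fun s hs => ⟨hs.1, hs.2.trans_lt ht.2⟩
  rw [eq_of_hasDerivAt_zero_Ioo (f := fun s => X ξ s) ((hX.continuousOn_time hmem).mono hsub)
    (fun s hs => ?_) (right_mem_Icc.2 ht.1), hX.initial ξ hmem]
  have hs' := hsub (Ioo_subset_Icc_self hs)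
  refine (hX.dynamics ξ hmem s ⟨hs.1, hs'.2⟩).congr_deriv ?_
  rw [lagrangeVelocity_eq_mul hL cm (hX.continuousOn_label hs') (hmono s hs') hmem]
  rcases hξ with rfl | rfl
  · rw [leftPotential, intervalIntegral.integral_same, zero_mul]
  · rw [rightPotential, intervalIntegral.integral_same, mul_zero]

theorem abs_displacement_sub_le (hX : IsLagrangeFlow L m₀ T X) (hL : 0 ≤ L) (cm : Continuous m₀)
    (hM : ∀ θ, |m₀ θ| ≤ M)
    (hmono : ∀ t ∈ Ico 0 T, StrictMonoOn (fun θ => X θ t) (Icc (-L) L)) {ξ η : ℝ}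
    (hξ : ξ ∈ Icc (-L) L) (hη : η ∈ Icc (-L) L) (h : ξ ≤ η) {t : ℝ} (ht : t ∈ Ico 0 T) :
    |(X η t - X ξ t) - (η - ξ)| ≤ 4 * L * M * T * ∫ θ in ξ..η, |m₀ θ| := by
  have hM0 : 0 ≤ M := (abs_nonneg _).trans (hM 0)
  have hI : 0 ≤ ∫ θ in ξ..η, |m₀ θ| := intervalIntegral.integral_nonneg h fun _ _ => abs_nonneg _
  have hT : 0 ≤ T := ht.1.trans ht.2.le
  rcases ht.1.eq_or_lt with rfl | h0
  · rw [hX.initial ξ hξ, hX.initial η hη, sub_self, abs_zero]; positivity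
  have hsub : Icc 0 t ⊆ Ico 0 T := fun s hs => ⟨hs.1, hs.2.trans_lt ht.2⟩
  obtain ⟨c, hc, hslope⟩ := exists_hasDerivAt_eq_slope (fun s => X η s - X ξ s)
    (fun s => lagrangeVelocity L m₀ X (X η s) s - lagrangeVelocity L m₀ X (X ξ s) s) h0
    (((hX.continuousOn_time hη).mono hsub).sub ((hX.continuousOn_time hξ).mono hsub))
    (fun s hs => (hX.dynamics η hη s ⟨hs.1, hs.2.trans ht.2⟩).sub
      (hX.dynamics ξ hξ s ⟨hs.1, hs.2.trans ht.2⟩))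
  have hc' := hsub (Ioo_subset_Icc_self hc)
  have hv := abs_lagrangeVelocity_label_sub_le hL cm hM (hX.continuousOn_label hc')
    (hmono c hc') hξ hη h
  rw [hslope, hX.initial ξ hξ, hX.initial η hη, sub_zero, abs_div, abs_of_pos h0,
    div_le_iff₀ h0] at hv
  refine hv.trans ?_
  rw [mul_right_comm]
  exact mul_le_mul_of_nonneg_right (mul_le_mul_of_nonneg_left ht.2.le (by positivity)) hI

end IsLagrangeFlow

/-! ### Particle positions at the final time -/

/-- The properties of the final particle positions `f = X(·, T)` that determine the limit measure:
`f` is nondecreasing, fixes the end points, and moves two labels relative to each other by at most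
a multiple of the mass between them. -/
structure IsLimitFlow (L A : ℝ) (m₀ f : ℝ → ℝ) : Prop where
  mono : MonotoneOn f (Icc (-L) L)
  left : f (-L) = -L
  right : f L = L
  displacement : ∀ ξ ∈ Icc (-L) L, ∀ η ∈ Icc (-L) L, ξ ≤ η →
    |(f η - f ξ) - (η - ξ)| ≤ A * ∫ θ in ξ..η, |m₀ θ|

theorem IsLagrangeFlow.exists_isLimitFlow {L T M : ℝ} {m₀ : ℝ → ℝ} {X : ℝ → ℝ → ℝ}
    (hX : IsLagrangeFlow L m₀ T X) (hL : 0 ≤ L) (hT : 0 < T) (cm : Continuous m₀)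
    (hM : ∀ θ, |m₀ θ| ≤ M)
    (hmono : ∀ t ∈ Ico 0 T, StrictMonoOn (fun θ => X θ t) (Icc (-L) L))
    (hXT : ∀ ξ ∈ Icc (-L) L, Tendsto (fun t => X ξ t) (𝓝[<] T) (𝓝 (X ξ T))) :
    ∃ A ≥ 0, IsLimitFlow L A m₀ fun ξ => X ξ T := by
  have hev : ∀ᶠ t in 𝓝[<] T, t ∈ Ico 0 T := by
    filter_upwards [Ioo_mem_nhdsLT hT] with t ht using Ioo_subset_Ico_self ht
  have hM0 : 0 ≤ M := (abs_nonneg _).trans (hM 0)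
  have hend : ∀ ξ, ξ = -L ∨ ξ = L → X ξ T = ξ := fun ξ hξ => by
    have hmem : ξ ∈ Icc (-L) L := by
      rcases hξ with rfl | rfl <;> constructor <;> linarith
    refine tendsto_nhds_unique (hXT ξ hmem) (tendsto_const_nhds.congr' ?_)
    filter_upwards [hev] with t ht using (hX.eq_of_endpoint hL cm hmono hξ ht).symm
  refine ⟨4 * L * M * T, by positivity, fun ξ hξ η hη h => ?_, hend _ (Or.inl rfl),
    hend _ (Or.inr rfl), fun ξ hξ η hη h => ?_⟩
  · refine le_of_tendsto_of_tendsto (hXT ξ hξ) (hXT η hη) ?_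
    filter_upwards [hev] with t ht using (hmono t ht).monotoneOn hξ hη h
  · refine le_of_tendsto ((((hXT η hη).sub (hXT ξ hξ)).sub_const (η - ξ)).abs) ?_
    filter_upwards [hev] with t ht using
      hX.abs_displacement_sub_le hL cm hM hmono hξ hη h ht

namespace IsLimitFlow

variable {L A M : ℝ} {m₀ f : ℝ → ℝ}

theorem continuousOn (hf : IsLimitFlow L A m₀ f) (hA : 0 ≤ A) (hM : ∀ θ, |m₀ θ| ≤ M) :
    ContinuousOn f (Icc (-L) L) := by
  have hM0 : 0 ≤ M := (abs_nonneg _).trans (hM 0)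
  have hlip : ∀ ξ ∈ Icc (-L) L, ∀ η ∈ Icc (-L) L, ξ ≤ η →
      |f η - f ξ| ≤ (1 + A * M) * |η - ξ| := by
    intro ξ hξ η hη h
    have h1 := (hf.displacement ξ hξ η hη h).trans
      (mul_le_mul_of_nonneg_left (integral_abs_le hM h) hA)
    rw [abs_of_nonneg (sub_nonneg.2 h)]
    rw [abs_le] at h1 ⊢
    have h2 : 0 ≤ A * (M * (η - ξ)) := mul_nonneg hA (mul_nonneg hM0 (sub_nonneg.2 h))
    constructor <;> linarith [h1.1, h1.2]
  refine (LipschitzOnWith.of_dist_le_mul (K := ⟨1 + A * M, by positivity⟩)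
    fun ξ hξ η hη => ?_).continuousOn
  rw [Real.dist_eq, Real.dist_eq]
  change |f ξ - f η| ≤ (1 + A * M) * |ξ - η|
  rcases le_total ξ η with h | h
  · rw [abs_sub_comm, abs_sub_comm ξ]; exact hlip ξ hξ η hη h
  · exact hlip η hη ξ hξ h

/-- `f` does not collapse labels near a zero of `m₀`: there the displacement bound makes `f`
expand by at least half. -/
theorem ne_zero_of_eq (hf : IsLimitFlow L A m₀ f) (hA : 0 ≤ A) (cm : Continuous m₀) {ξ η ζ : ℝ}
    (hξ : ξ ∈ Icc (-L) L) (hη : η ∈ Icc (-L) L) (hlt : ξ < η) (heq : f ξ = f η)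
    (hζ : ζ ∈ Icc ξ η) : m₀ ζ ≠ 0 := by
  intro hz
  obtain ⟨δ, hδ, hsmall⟩ := Metric.continuousAt_iff.1 (cm.continuousAt (x := ζ))
    (1 / (2 * (A + 1))) (by positivity)
  set a := max ξ (ζ - δ / 2) with ha
  set b := min η (ζ + δ / 2) with hb
  have haζ : a ≤ ζ := max_le hζ.1 (by linarith)
  have hζb : ζ ≤ b := le_min hζ.2 (by linarith)
  have hab : a < b := by
    rcases hζ.1.eq_or_lt with h | h
    · exact haζ.trans_lt (lt_min (by linarith) (by linarith))
    · exact (max_lt h (by linarith)).trans_le hζb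
  have haI : a ∈ Icc ξ η := ⟨le_max_left _ _, haζ.trans hζ.2⟩
  have hbI : b ∈ Icc ξ η := ⟨hζ.1.trans hζb, min_le_left _ _⟩
  have hsub : Icc ξ η ⊆ Icc (-L) L := Icc_subset_Icc hξ.1 hη.2
  -- `f` is constant on `[ξ, η]`, hence on the small interval `[a, b]` around `ζ`
  have hfab : f a = f b := by
    have h1 := hf.mono hξ (hsub haI) haI.1
    have h2 := hf.mono (hsub haI) (hsub hbI) hab.le
    have h3 := hf.mono (hsub hbI) hη hbI.2
    linarith
  have hint : ∫ θ in a..b, |m₀ θ| ≤ 1 / (2 * (A + 1)) * (b - a) := by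
    have := intervalIntegral.norm_integral_le_of_norm_le_const (a := a) (b := b)
      (f := fun θ => |m₀ θ|) (C := 1 / (2 * (A + 1))) (fun θ hθ => by
        rw [uIoc_of_le hab.le] at hθ
        have h1 : dist θ ζ < δ := by
          rw [Real.dist_eq, abs_lt]
          have := le_max_right ξ (ζ - δ / 2)
          have := min_le_right η (ζ + δ / 2)
          constructor <;> linarith [hθ.1, hθ.2]
        have h2 := hsmall h1
        rw [hz, Real.dist_eq, sub_zero] at h2
        simpa using h2.le)
    rw [abs_of_pos (sub_pos.2 hab)] at this
    exact (le_abs_self _).trans this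
  have hd := hf.displacement a (hsub haI) b (hsub hbI) hab.le
  rw [hfab, sub_self, zero_sub, abs_neg, abs_of_pos (sub_pos.2 hab)] at hd
  have h1 := hd.trans (mul_le_mul_of_nonneg_left hint hA)
  have h2 : A * (1 / (2 * (A + 1)) * (b - a)) ≤ (b - a) / 2 := by
    have : A * (1 / (2 * (A + 1))) ≤ 1 / 2 := by
      rw [mul_one_div, div_le_div_iff₀ (by positivity) (by norm_num)]; linarith
    nlinarith
  linarith

/-- Labels which end at the same point carry momentum of the same sign. -/
theorem pos_of_eq (hf : IsLimitFlow L A m₀ f) (hA : 0 ≤ A) (cm : Continuous m₀) {ξ η : ℝ}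
    (hξ : ξ ∈ Icc (-L) L) (hη : η ∈ Icc (-L) L) (heq : f ξ = f η) (hpos : 0 < m₀ ξ) :
    0 < m₀ η := by
  by_contra! hle
  have hivt := intermediate_value_uIcc (a := ξ) (b := η) cm.continuousOn
  obtain ⟨ζ, hζ, hz⟩ := hivt (show (0 : ℝ) ∈ uIcc (m₀ ξ) (m₀ η) from
    mem_uIcc.2 (Or.inr ⟨hle, hpos.le⟩))
  have hne : ξ ≠ η := fun h => by subst h; linarith
  rcases hne.lt_or_gt with h | h
  · rw [uIcc_of_le h.le] at hζ
    exact hf.ne_zero_of_eq hA cm hξ hη h heq hζ hz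
  · rw [uIcc_of_ge h.le] at hζ
    exact hf.ne_zero_of_eq hA cm hη hξ h heq.symm hζ hz

theorem abs_le_of_abs_le (hf : IsLimitFlow L A m₀ f) {r ξ : ℝ} (hr : 0 ≤ r) (hrL : r ≤ L)
    (hz : ∀ x, r < |x| → m₀ x = 0) (hξ : |ξ| ≤ r) : |f ξ| ≤ r := by
  have hmem : ∀ x, |x| ≤ r → x ∈ Icc (-L) L := fun x hx => abs_le.1 (hx.trans hrL)
  have hl : -L ∈ Icc (-L) L := ⟨le_rfl, by linarith⟩
  have hR : L ∈ Icc (-L) L := ⟨by linarith, le_rfl⟩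
  have hr1 : r ∈ Icc (-L) L := ⟨by linarith, hrL⟩
  have hr2 : -r ∈ Icc (-L) L := ⟨by linarith, by linarith⟩
  have d1 := hf.displacement (-L) hl (-r) hr2 (by linarith)
  have d2 := hf.displacement r hr1 L hR hrL
  have z1 : ∫ θ in (-L)..(-r), |m₀ θ| = 0 := by
    rw [intervalIntegral.integral_of_le (by linarith), integral_Ioc_eq_integral_Ioo]
    refine setIntegral_eq_zero_of_forall_eq_zero fun θ hθ => ?_
    rw [hz θ (by rw [lt_abs]; right; linarith [hθ.2]), abs_zero]
  have z2 : ∫ θ in r..L, |m₀ θ| = 0 := by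
    rw [intervalIntegral.integral_of_le hrL]
    refine setIntegral_eq_zero_of_forall_eq_zero fun θ hθ => ?_
    rw [hz θ (by rw [lt_abs]; left; exact hθ.1), abs_zero]
  rw [z1, mul_zero, hf.left] at d1
  rw [z2, mul_zero, hf.right] at d2
  have e1 := abs_nonpos_iff.1 d1
  have e2 := abs_nonpos_iff.1 d2
  have h1 := hf.mono hr2 (hmem ξ hξ) (abs_le.1 hξ).1
  have h2 := hf.mono (hmem ξ hξ) hr1 (abs_le.1 hξ).2
  exact abs_le.2 ⟨by linarith, by linarith⟩

end IsLimitFlow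

/-! ### Signed measures on the line -/

theorem vectorIntegral_toSignedMeasure_sub {a b : Measure ℝ} [IsFiniteMeasure a]
    [IsFiniteMeasure b] (φ : C₀(ℝ, ℝ)) :
    ∫ᵛ x, φ x ∂•(a.toSignedMeasure - b.toSignedMeasure) = ∫ x, φ x ∂a - ∫ x, φ x ∂b := by
  have hflip : (ContinuousLinearMap.lsmul ℝ ℝ : ℝ →L[ℝ] ℝ →L[ℝ] ℝ)
      = (ContinuousLinearMap.lsmul ℝ ℝ).flip := by
    ext; simp
  have hi : ∀ (ν : Measure ℝ) [IsFiniteMeasure ν], ν.toSignedMeasure.Integrable φ := by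
    intro ν _
    change Integrable φ ν.toSignedMeasure.variation
    rw [Measure.variation_toSignedMeasure]
    exact φ.toBCF.integrable ν
  rw [VectorMeasure.integral_sub_vectorMeasure (hi a) (hi b), hflip,
    VectorMeasure.integral_toSignedMeasure, VectorMeasure.integral_toSignedMeasure]

/-- A finite signed measure on `ℝ` is determined by its integrals against `C₀(ℝ)`. -/
theorem SignedMeasure.ext_of_integral_eq {μ ν : SignedMeasure ℝ}
    (h : ∀ φ : C₀(ℝ, ℝ), ∫ᵛ x, φ x ∂•μ = ∫ᵛ x, φ x ∂•ν) : μ = ν := by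
  rw [← μ.toSignedMeasure_toJordanDecomposition, ← ν.toSignedMeasure_toJordanDecomposition] at h ⊢
  simp only [JordanDecomposition.toSignedMeasure] at h ⊢
  set a := μ.toJordanDecomposition.posPart
  set b := μ.toJordanDecomposition.negPart
  set c := ν.toJordanDecomposition.posPart
  set d := ν.toJordanDecomposition.negPart
  have key : a + d = c + b := by
    refine Measure.ext_of_integral_eq_on_compactlySupported fun f => ?_
    have hf := h ⟨f.toContinuousMap, f.hasCompactSupport.is_zero_at_infty⟩
    rw [vectorIntegral_toSignedMeasure_sub, vectorIntegral_toSignedMeasure_sub] at hf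
    have hi : ∀ κ : Measure ℝ, IsFiniteMeasure κ → Integrable f κ := fun κ _ =>
      f.continuous.integrable_of_hasCompactSupport f.hasCompactSupport
    rw [integral_add_measure (hi a inferInstance) (hi d inferInstance),
      integral_add_measure (hi c inferInstance) (hi b inferInstance)]
    change ∫ x, f x ∂a - ∫ x, f x ∂b = ∫ x, f x ∂c - ∫ x, f x ∂d at hf
    linarith
  ext B hB
  have hB' : (a + d).real B = (c + b).real B := congrArg (fun κ : Measure ℝ => κ.real B) key
  rw [measureReal_add_apply, measureReal_add_apply] at hB'
  simp only [sub_apply, Measure.toSignedMeasure_apply_measurable hB]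
  linarith

/-- If `a` is concentrated on `S` and `b` does not charge `S`, restricting `a - b` to `S` leaves
`a`. -/
theorem restrict_toSignedMeasure_sub {a b : Measure ℝ} [IsFiniteMeasure a] [IsFiniteMeasure b]
    {S : Set ℝ} (hS : MeasurableSet S) (ha : a Sᶜ = 0) (hb : b S = 0) :
    (a.toSignedMeasure - b.toSignedMeasure).restrict S = a.toSignedMeasure := by
  ext B hB
  have h1 : b.real (B ∩ S) = 0 := by
    rw [measureReal_def, measure_mono_null inter_subset_right hb, ENNReal.toReal_zero]
  have h2 : a.real (B ∩ S) = a.real B := by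
    rw [measureReal_def, measureReal_def, measure_inter_conull ha]
  rw [VectorMeasure.restrict_apply _ hS hB]
  simp only [sub_apply, Measure.toSignedMeasure_apply_measurable (hB.inter hS),
    Measure.toSignedMeasure_apply_measurable hB, h1, h2, sub_zero]

theorem variation_toSignedMeasure_sub {a b : Measure ℝ} [IsFiniteMeasure a] [IsFiniteMeasure b]
    {S : Set ℝ} (hS : MeasurableSet S) (ha : a Sᶜ = 0) (hb : b S = 0) :
    (a.toSignedMeasure - b.toSignedMeasure).variation = a + b := by
  have hsing : a ⟂ₘ b := ⟨Sᶜ, hS.compl, ha, by rwa [compl_compl]⟩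
  set j : JordanDecomposition ℝ := ⟨a, b, hsing⟩
  have hj : (a.toSignedMeasure - b.toSignedMeasure).toJordanDecomposition = j :=
    SignedMeasure.toJordanDecomposition_eq rfl
  rw [← SignedMeasure.totalVariation_eq_variation, SignedMeasure.totalVariation, hj]

theorem measurableSet_image_of_isOpen {f : ℝ → ℝ} {L : ℝ} (hf : ContinuousOn f (Icc (-L) L))
    {U : Set ℝ} (hU : IsOpen U) (hUL : U ⊆ Icc (-L) L) : MeasurableSet (f '' U) := by
  obtain ⟨F, hFc, -, hFU, -⟩ := hU.exists_iUnion_isClosed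
  rw [← hFU, image_iUnion]
  refine MeasurableSet.iUnion fun n => ?_
  have hn : F n ⊆ Icc (-L) L := (hFU ▸ subset_iUnion F n : F n ⊆ U).trans hUL
  exact ((isCompact_Icc.of_isClosed_subset (hFc n) hn).image_of_continuousOn
    (hf.mono hn)).measurableSet

/-! ### The limit measure -/

/-- The push-forward of the positive part of `m₀ dξ` on `[-L, L]` under `f`. The map is extended
from `[-L, L]` to `ℝ` by constants, so that it is continuous everywhere. -/
noncomputable def pushPosPart (L : ℝ) (hL : -L ≤ L) (m₀ f : ℝ → ℝ) : Measure ℝ :=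
  (posPartMeasure (volume.restrict (Icc (-L) L)) m₀).map (IccExtend hL (domRestrict (Icc (-L) L) f))

section PushForward

variable {L A M : ℝ} {hL : -L ≤ L} {m₀ f : ℝ → ℝ}

theorem continuous_extend (hf : ContinuousOn f (Icc (-L) L)) :
    Continuous (IccExtend hL (domRestrict (Icc (-L) L) f)) :=
  continuous_IccExtend_iff.2 (continuousOn_iff_continuous_domRestrict.1 hf)

theorem extend_eq {ξ : ℝ} (hξ : ξ ∈ Icc (-L) L) :
    IccExtend hL (domRestrict (Icc (-L) L) f) ξ = f ξ := by
  rw [IccExtend_of_mem _ _ hξ]; rfl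

theorem isFiniteMeasure_pushPosPart (cm : Continuous m₀) :
    IsFiniteMeasure (pushPosPart L hL m₀ f) := by
  have := isFiniteMeasure_posPartMeasure
    (cm.integrableOn_Icc (μ := volume) (a := -L) (b := L))
  unfold pushPosPart
  infer_instance

theorem pushPosPart_apply (hf : ContinuousOn f (Icc (-L) L)) {B : Set ℝ} (hB : MeasurableSet B) :
    pushPosPart L hL m₀ f B
      = ∫⁻ ξ in IccExtend hL (domRestrict (Icc (-L) L) f) ⁻¹' B ∩ Icc (-L) L,
        ENNReal.ofReal (m₀ ξ) := by
  have hmeas := (continuous_extend (hL := hL) hf).measurable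
  rw [pushPosPart, Measure.map_apply hmeas hB, posPartMeasure, withDensity_apply _ (hmeas hB),
    Measure.restrict_restrict (hmeas hB)]

theorem pushPosPart_eq_zero (hf : ContinuousOn f (Icc (-L) L)) {B : Set ℝ} (hB : MeasurableSet B)
    (h : ∀ ξ ∈ Icc (-L) L, f ξ ∈ B → m₀ ξ ≤ 0) : pushPosPart L hL m₀ f B = 0 := by
  have hmeas := (continuous_extend (hL := hL) hf).measurable
  rw [pushPosPart_apply hf hB]
  refine setLIntegral_eq_zero ((hmeas hB).inter measurableSet_Icc) fun ξ hξ => ?_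
  have h1 : f ξ ∈ B := by
    have := hξ.1
    rwa [mem_preimage, extend_eq hξ.2] at this
  exact ENNReal.ofReal_of_nonpos (h ξ hξ.2 h1)

theorem pushPosPart_real_sub (hf : ContinuousOn f (Icc (-L) L)) (cm : Continuous m₀) {B : Set ℝ}
    (hB : MeasurableSet B) :
    (pushPosPart L hL m₀ f).real B - (pushPosPart L hL (fun ξ => -m₀ ξ) f).real B
      = ∫ ξ in Icc (-L) L ∩ {ξ | f ξ ∈ B}, m₀ ξ := by
  have hmeas := (continuous_extend (hL := hL) hf).measurable
  rw [pushPosPart, pushPosPart, map_measureReal_apply hmeas hB, map_measureReal_apply hmeas hB,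
    posPartMeasure_real_sub (cm.integrableOn_Icc (μ := volume)) (hmeas hB),
    Measure.restrict_restrict (hmeas hB)]
  congr 2
  ext ξ
  constructor
  · rintro ⟨h1, h2⟩
    rw [mem_preimage, extend_eq h2] at h1
    exact ⟨h2, h1⟩
  · rintro ⟨h1, h2⟩
    refine ⟨?_, h1⟩
    rw [mem_preimage, extend_eq h1]
    exact h2

theorem integral_pushPosPart_sub (hf : ContinuousOn f (Icc (-L) L)) (cm : Continuous m₀)
    (φ : C₀(ℝ, ℝ)) :
    ∫ x, φ x ∂(pushPosPart L hL m₀ f) - ∫ x, φ x ∂(pushPosPart L hL (fun ξ => -m₀ ξ) f)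
      = ∫ ξ in (-L)..L, φ (f ξ) * m₀ ξ := by
  have hmeas := (continuous_extend (hL := hL) hf).measurable
  have mφ : Measurable φ := φ.continuous.measurable
  rw [pushPosPart, pushPosPart, integral_map hmeas.aemeasurable mφ.aestronglyMeasurable,
    integral_map hmeas.aemeasurable mφ.aestronglyMeasurable]
  have := integral_posPartMeasure_sub (cm.integrableOn_Icc (μ := volume) (a := -L) (b := L))
    cm.measurable (mφ.comp hmeas) (fun x => φ.toBCF.norm_coe_le_norm _)
  simp only [Function.comp] at this
  rw [this, intervalIntegral.integral_of_le hL, ← integral_Icc_eq_integral_Ioc]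
  refine setIntegral_congr_fun measurableSet_Icc fun ξ hξ => ?_
  simp only [extend_eq hξ]

theorem pushPosPart_univ_add (hf : ContinuousOn f (Icc (-L) L)) (cm : Continuous m₀) :
    pushPosPart L hL m₀ f univ + pushPosPart L hL (fun ξ => -m₀ ξ) f univ
      = ENNReal.ofReal (∫ ξ in (-L)..L, |m₀ ξ|) := by
  rw [pushPosPart_apply hf MeasurableSet.univ, pushPosPart_apply hf MeasurableSet.univ,
    ← lintegral_add_left cm.measurable.ennreal_ofReal, preimage_univ, univ_inter,
    intervalIntegral.integral_of_le hL, ← integral_Icc_eq_integral_Ioc,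
    ofReal_integral_eq_lintegral_ofReal cm.abs.integrableOn_Icc
      (Eventually.of_forall fun _ => abs_nonneg _)]
  refine lintegral_congr fun ξ => ?_
  rcases le_total 0 (m₀ ξ) with h | h
  · rw [abs_of_nonneg h, ENNReal.ofReal_of_nonpos (neg_nonpos.2 h), add_zero]
  · rw [abs_of_nonpos h, ENNReal.ofReal_of_nonpos h, zero_add]

end PushForward

/-! ### Conclusion -/

theorem IsLimitFlow.neg {L A : ℝ} {m₀ f : ℝ → ℝ} (hf : IsLimitFlow L A m₀ f) :
    IsLimitFlow L A (fun ξ => -m₀ ξ) f :=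
  ⟨hf.mono, hf.left, hf.right, by simpa only [abs_neg] using hf.displacement⟩

theorem exists_support_radius {L : ℝ} {m₀ : ℝ → ℝ} (hL : 0 < L)
    (hsupp : tsupport m₀ ⊆ Ioo (-L) L) : ∃ r, 0 ≤ r ∧ r < L ∧ ∀ x, r < |x| → m₀ x = 0 := by
  rcases (tsupport m₀).eq_empty_or_nonempty with h | h
  · refine ⟨0, le_rfl, hL, fun x _ => image_eq_zero_of_notMem_tsupport (by simp [h])⟩
  · have hc : IsCompact (tsupport m₀) :=
      isCompact_Icc.of_isClosed_subset (isClosed_tsupport m₀) (hsupp.trans Ioo_subset_Icc_self)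
    obtain ⟨a, ha, hmax⟩ := hc.exists_isMaxOn h (f := fun x : ℝ => |x|) (by fun_prop)
    refine ⟨|a|, abs_nonneg _, abs_lt.2 (hsupp ha), fun x hx => ?_⟩
    exact image_eq_zero_of_notMem_tsupport fun hx' => absurd (hmax hx') (not_le.2 hx)

theorem theorem5p3 (L : ℝ) (hL : 0 < L) (m₀ : ℝ → ℝ)
    (hm₀ : ContDiff ℝ 1 m₀) (hsupp : tsupport m₀ ⊆ Ioo (-L) L)
    (T : ℝ) (hT : 0 < T) (u m X : ℝ → ℝ → ℝ)
    (hsol : IsMaximalClassicalSolution m₀ T u m)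
    (hX : IsLagrangeFlow L m₀ T X)
    (hXT : ∀ ξ ∈ Icc (-L) L, Tendsto (fun t => X ξ t) (𝓝[<] T) (𝓝 (X ξ T))) :
    -- each `m(·,t)` is a finite signed measure
    (∀ t ∈ Ico 0 T, Integrable (fun x => m x t)) ∧
    ∃ μ : SignedMeasure ℝ,
      -- existence and uniqueness of the weak-* limit
      WeakStarLimit m T μ ∧
      (∀ ν : SignedMeasure ℝ, WeakStarLimit m T ν → ν = μ) ∧
      -- `μ` is the push-forward of `m₀` under `X(·,T)`
      (∀ B : Set ℝ, MeasurableSet B →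
        μ B = ∫ ξ in Icc (-L) L ∩ {ξ | X ξ T ∈ B}, m₀ ξ) ∧
      -- compact support in `(-L,L)`
      IsCompact μ.variation.support ∧ μ.variation.support ⊆ Ioo (-L) L ∧
      -- decomposition into a positive and a negative measure
      MeasurableSet (positiveImage L m₀ X T) ∧
      MeasurableSet (negativeImage L m₀ X T) ∧
      0 ≤ μ.restrict (positiveImage L m₀ X T) ∧
      μ.restrict (negativeImage L m₀ X T) ≤ 0 ∧
      μ = μ.restrict (positiveImage L m₀ X T) + μ.restrict (negativeImage L m₀ X T) ∧
      -- conservation of the total variation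
      μ.variation univ = ENNReal.ofReal (∫ ξ in (-L)..L, |m₀ ξ|) ∧
      ∀ t ∈ Ico 0 T, ∫ x, |m x t| = ∫ ξ in (-L)..L, |m₀ ξ| := by
  have cm : Continuous m₀ := hm₀.continuous
  have hLL : -L ≤ L := by linarith
  obtain ⟨r, hr0, hrL, hr⟩ := exists_support_radius hL hsupp
  have zm : ∀ x, L ≤ |x| → m₀ x = 0 := fun x hx => hr x (hrL.trans_le hx)
  obtain ⟨M, hM⟩ : ∃ M, ∀ θ, |m₀ θ| ≤ M := by
    have hcs : HasCompactSupport m₀ :=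
      isCompact_Icc.of_isClosed_subset (isClosed_tsupport m₀) (hsupp.trans Ioo_subset_Icc_self)
    exact hcs.exists_bound_of_continuous cm
  have htr : ∀ t ∈ Ico 0 T, _ := fun t ht =>
    hX.exists_isTransportedSolution hL.le hsol.1 cm ⟨M, hM⟩ zm ht
  have hmono : ∀ t ∈ Ico 0 T, StrictMonoOn (fun θ => X θ t) (Icc (-L) L) := by
    intro t ht
    obtain ⟨ux, mx, Y, C, hY, hXY⟩ := htr t ht
    have htt : t ∈ Icc 0 t := right_mem_Icc.2 ht.1
    intro ξ hξ η hη h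
    simp only [hXY ξ hξ t htt, hXY η hη t htt]
    exact hY.flow.strictMono hY.sol.isRegularField htt h
  obtain ⟨A, hA, hf⟩ := hX.exists_isLimitFlow hL.le hT cm hM hmono hXT
  set f : ℝ → ℝ := fun ξ => X ξ T with hfdef
  have cf := hf.continuousOn hA hM
  have hpush : ∀ φ : C₀(ℝ, ℝ), ∀ t ∈ Ico 0 T,
      ∫ x, φ x * m x t = ∫ θ in (-L)..L, φ (X θ t) * m₀ θ := by
    intro φ t ht
    obtain ⟨ux, mx, Y, C, hY, hXY⟩ := htr t ht
    have htt : t ∈ Icc 0 t := right_mem_Icc.2 ht.1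
    rw [hY.integral_mul_eq htt (φ := fun x => φ x) φ.continuous.measurable
      (fun x => φ.toBCF.norm_coe_le_norm x),
      hY.integral_eq_intervalIntegral hL.le]
    refine intervalIntegral.integral_congr fun θ hθ => ?_
    rw [uIcc_of_le hLL] at hθ
    simp only [hXY θ hθ t htt]
  have hlim : ∀ φ : C₀(ℝ, ℝ), Tendsto (fun t => ∫ x, φ x * m x t) (𝓝[<] T)
      (𝓝 (∫ θ in (-L)..L, φ (f θ) * m₀ θ)) := by
    intro φ
    have hev : ∀ᶠ t in 𝓝[<] T, t ∈ Ico 0 T := by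
      filter_upwards [Ioo_mem_nhdsLT hT] with t ht using Ioo_subset_Ico_self ht
    have key : Tendsto (fun t => ∫ θ in (-L)..L, φ (X θ t) * m₀ θ) (𝓝[<] T)
        (𝓝 (∫ θ in (-L)..L, φ (f θ) * m₀ θ)) := by
      refine intervalIntegral.tendsto_integral_filter_of_dominated_convergence
        (fun _ => ‖φ.toBCF‖ * M) ?_ ?_ intervalIntegrable_const ?_
      · filter_upwards [hev] with t ht
        rw [uIoc_of_le hLL]
        exact (((φ.continuous.comp_continuousOn (hX.continuousOn_label ht)).mul
          cm.continuousOn).mono Ioc_subset_Icc_self).aestronglyMeasurable measurableSet_Ioc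
      · refine Eventually.of_forall fun t => Eventually.of_forall fun θ _ => ?_
        rw [norm_mul]
        exact mul_le_mul (φ.toBCF.norm_coe_le_norm _) (hM θ) (norm_nonneg _) (norm_nonneg _)
      · refine Eventually.of_forall fun θ hθ => ?_
        rw [uIoc_of_le hLL] at hθ
        exact ((φ.continuous.tendsto _).comp (hXT θ (Ioc_subset_Icc_self hθ))).mul_const _
    refine key.congr' ?_
    filter_upwards [hev] with t ht using (hpush φ t ht).symm
  set a := pushPosPart L hLL m₀ f with ha
  set b := pushPosPart L hLL (fun ξ => -m₀ ξ) f with hb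
  have fa : IsFiniteMeasure a := isFiniteMeasure_pushPosPart cm
  have fb : IsFiniteMeasure b := isFiniteMeasure_pushPosPart cm.neg
  have hweak : ∀ ν : SignedMeasure ℝ, WeakStarLimit m T ν ↔
      ∀ φ : C₀(ℝ, ℝ), ∫ᵛ x, φ x ∂•ν = ∫ᵛ x, φ x ∂•(a.toSignedMeasure - b.toSignedMeasure) := by
    intro ν
    refine forall_congr' fun φ => ?_
    rw [vectorIntegral_toSignedMeasure_sub, ha, hb, integral_pushPosPart_sub cf cm]
    exact ⟨fun h => tendsto_nhds_unique h (hlim φ), fun h => by rw [h]; exact hlim φ⟩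
  -- `m₀` vanishes at `±L`, so closed and open label intervals give the same images
  have hmem : ∀ ξ ∈ Icc (-L) L, m₀ ξ ≠ 0 → ξ ∈ Ioo (-L) L := by
    intro ξ hξ h
    by_contra hn
    exact h (zm ξ (not_lt.1 fun h' => hn (abs_lt.1 h')))
  have mA : MeasurableSet (positiveImage L m₀ X T) :=
    measurableSet_image_of_isOpen cf (isOpen_Ioo.inter (isOpen_Ioi.preimage cm))
      fun ξ hξ => Ioo_subset_Icc_self hξ.1
  have mB : MeasurableSet (negativeImage L m₀ X T) :=
    measurableSet_image_of_isOpen cf (isOpen_Ioo.inter (isOpen_Iio.preimage cm))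
      fun ξ hξ => Ioo_subset_Icc_self hξ.1
  have aA : a (positiveImage L m₀ X T)ᶜ = 0 := pushPosPart_eq_zero cf mA.compl fun ξ hξ h => by
    by_contra! hpos
    exact h ⟨ξ, ⟨hmem ξ hξ hpos.ne', hpos⟩, rfl⟩
  -- the labels that end in the positive image all carry positive momentum
  have bA : b (positiveImage L m₀ X T) = 0 := pushPosPart_eq_zero cf mA fun ξ hξ h => by
    obtain ⟨η, ⟨hη, hpos⟩, heq⟩ := h
    have := hf.pos_of_eq hA cm (Ioo_subset_Icc_self hη) hξ heq hpos
    linarith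
  have bB : b (negativeImage L m₀ X T)ᶜ = 0 := pushPosPart_eq_zero cf mB.compl fun ξ hξ h => by
    by_contra! hpos
    exact h ⟨ξ, ⟨hmem ξ hξ (by linarith [hpos]), by linarith [hpos]⟩, rfl⟩
  have aB : a (negativeImage L m₀ X T) = 0 := pushPosPart_eq_zero cf mB fun ξ hξ h => by
    obtain ⟨η, ⟨hη, hneg⟩, heq⟩ := h
    have := hf.neg.pos_of_eq hA cm.neg (Ioo_subset_Icc_self hη) hξ heq (by linarith)
    linarith
  have rA := restrict_toSignedMeasure_sub mA aA bA
  have rB : (a.toSignedMeasure - b.toSignedMeasure).restrict (negativeImage L m₀ X T)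
      = -b.toSignedMeasure := by
    rw [← neg_sub, VectorMeasure.restrict_neg, restrict_toSignedMeasure_sub mB bB aB]
  have hvar := variation_toSignedMeasure_sub mA aA bA
  have hsub : (a + b).support ⊆ Icc (-r) r := by
    refine Measure.support_subset_of_isClosed isClosed_Icc ?_
    have hz : ∀ ξ ∈ Icc (-L) L, f ξ ∈ (Icc (-r) r)ᶜ → m₀ ξ = 0 := by
      intro ξ _ h
      refine hr ξ (not_le.1 fun hle => h ?_)
      exact abs_le.1 (hf.abs_le_of_abs_le hr0 hrL.le hr hle)
    rw [mem_ae_iff, Measure.add_apply,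
      pushPosPart_eq_zero cf measurableSet_Icc.compl fun ξ hξ h => (hz ξ hξ h).le,
      pushPosPart_eq_zero cf measurableSet_Icc.compl fun ξ hξ h => by rw [hz ξ hξ h, neg_zero],
      add_zero]
  refine ⟨fun t ht => ?_, a.toSignedMeasure - b.toSignedMeasure, (hweak _).2 fun _ => rfl,
    fun ν hν => SignedMeasure.ext_of_integral_eq ((hweak ν).1 hν), fun B hB => ?_, ?_, ?_, mA, mB,
    ?_, ?_, ?_, ?_, fun t ht => ?_⟩
  · obtain ⟨ux, mx, Y, C, hY, -⟩ := htr t ht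
    exact hY.integrable (right_mem_Icc.2 ht.1)
  · rw [← pushPosPart_real_sub (hL := hLL) cf cm hB, sub_apply,
      Measure.toSignedMeasure_apply_measurable hB, Measure.toSignedMeasure_apply_measurable hB]
  · rw [hvar]
    exact isCompact_Icc.of_isClosed_subset Measure.isClosed_support hsub
  · rw [hvar]
    exact hsub.trans (Icc_subset_Ioo (by linarith) hrL)
  · rw [rA]
    exact Measure.zero_le_toSignedMeasure a
  · rw [rB]
    exact neg_nonpos.2 (Measure.zero_le_toSignedMeasure b)
  · rw [rA, rB, sub_eq_add_neg]
  · rw [hvar, Measure.add_apply]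
    exact pushPosPart_univ_add cf cm
  · obtain ⟨ux, mx, Y, C, hY, -⟩ := htr t ht
    exact hY.integral_abs_eq hL.le (right_mem_Icc.2 ht.1)
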